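/- Let $\mathcal H$ be a complex Hilbert space. For a bounded self-adjoint operator $T$ on $\mathcal H$ let $\Xi(T)=E_T((-\infty,0))$ be the spectral projection of $T$ corresponding to the open negative half-axis. Let $S=S^*$ be a bounded operator on $\mathcal H$, let $B\ge 0$ be a trace class operator on $\mathcal H$, and assume that $S+\tau_0B$ has a bounded inverse for some $\tau_0\in\mathbb R$. Then $\ker(S+sB)$ is finite-dimensional for every $s\in(-1,1]$ and non-zero for only finitely many such $s$, the operators $\Xi(S+B)-\Xi(S)$ and $\Xi(S-B)-\Xi(S)$ are trace class, and $$\operatorname{tr}\big(\Xi(S+B)-\Xi(S)\big)=-\sum_{s\in(0,1]}\dim\ker(S+sB),$$ $$\operatorname{tr}\big(\Xi(S-B)-\Xi(S)\big)=\sum_{s\in(-1,0]}\dim\ker(S+sB).$$ -/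

import Mathlib

open scoped InnerProductSpace

noncomputable section

variable {H : Type*} [NormedAddCommGroup H] [InnerProductSpace ℂ H] [CompleteSpace H]

/-- `T` is trace class: the sum of the diagonal entries `⟨bᵢ, |T| bᵢ⟩` (nonnegative reals) of
`|T| = (T* T)^{1/2}` in some orthonormal basis converges. As `|T| ≥ 0`, that sum does not depend on
the orthonormal basis. -/
def IsTraceClass (T : H →L[ℂ] H) : Prop :=
  ∃ (w : Set H) (b : HilbertBasis w ℂ H),
    Summable fun i : w => (⟪b i, (CFC.abs T) (b i)⟫_ℂ).re

/-- `T` is trace class and its trace is `c`: in every orthonormal basis the sum of the diagonal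
entries of `T` converges (absolutely) to `c`. -/
def HasTrace (T : H →L[ℂ] H) (c : ℂ) : Prop :=
  IsTraceClass T ∧
    ∀ (w : Set H) (b : HilbertBasis w ℂ H), HasSum (fun i : w => ⟪b i, T (b i)⟫_ℂ) c

/-- For a bounded self-adjoint operator `T`, the spectral projection `Ξ(T) = E_T((-∞, 0))`, as the
orthogonal projection onto the closure of the range of the negative part `T⁻` of `T` (given by the
continuous functional calculus). The two theorems below identify it with the value at the
indicator function of `(-∞, 0)` of the Borel functional calculus of `T`. -/
def Xi (T : H →L[ℂ] H) : H →L[ℂ] H :=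
  (LinearMap.range ((T⁻ : H →L[ℂ] H) : H →ₗ[ℂ] H)).topologicalClosure.starProjection

/-- `Ξ(T)` is the strong limit of `fₙ(T)`, where the continuous functions
`fₙ(t) = min (1, n t⁻)` increase pointwise to the indicator function of `(-∞, 0)`. -/
theorem tendsto_cfc_Xi (T : H →L[ℂ] H) (hT : IsSelfAdjoint T) (x : H) :
    Filter.Tendsto (fun n : ℕ => (cfc (fun t : ℝ => min 1 ((n : ℝ) * t⁻)) T) x) Filter.atTop
      (nhds (Xi T x)) := by
  have hneg : (T⁻ : H →L[ℂ] H) = cfc (fun t : ℝ => t⁻) T := by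
    rw [CFC.negPart_def, cfcₙ_eq_cfc (by fun_prop) (by simp)]
  have hcf (n : ℕ) : Continuous (fun t : ℝ => min 1 ((n : ℝ) * t⁻)) := by fun_prop
  have hn0 (t : ℝ) : 0 ≤ t⁻ := negPart_nonneg t
  set f : ℕ → (H →L[ℂ] H) := fun n => cfc (fun t : ℝ => min 1 ((n : ℝ) * t⁻)) T with hf
  have hf1 (n : ℕ) : ‖f n‖ ≤ 1 := by
    refine norm_cfc_le zero_le_one fun t _ => ?_
    rw [Real.norm_of_nonneg (le_min zero_le_one (mul_nonneg n.cast_nonneg (hn0 t)))]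
    exact min_le_left _ _
  set K := (LinearMap.range ((T⁻ : H →L[ℂ] H) : H →ₗ[ℂ] H)).topologicalClosure with hK
  -- on the orthogonal complement of `K`
  have hker (v : H) (hv : v ∈ Kᗮ) (n : ℕ) : f n v = 0 := by
    have hv' : (T⁻ : H →L[ℂ] H) v = 0 := by
      rw [hK, Submodule.orthogonal_closure] at hv
      have := (ContinuousLinearMap.orthogonal_range (T⁻ : H →L[ℂ] H)) ▸ hv
      have hsa : ContinuousLinearMap.adjoint (T⁻ : H →L[ℂ] H) = T⁻ := by
        rw [← ContinuousLinearMap.star_eq_adjoint, hneg]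
        exact (cfc_predicate (fun t : ℝ => t⁻) T).star_eq
      rw [hsa] at this
      exact this
    have hc : Continuous (fun t : ℝ => (n : ℝ) / max 1 ((n : ℝ) * t⁻)) :=
      Continuous.div (by fun_prop) (by fun_prop) fun t => by positivity
    have : f n = cfc (fun t : ℝ => (n : ℝ) / max 1 ((n : ℝ) * t⁻)) T * T⁻ := by
      rw [hneg, ← cfc_mul _ _ T hc.continuousOn (by fun_prop)]
      simp only [hf]
      congr 1
      funext t
      rcases le_total 1 ((n : ℝ) * t⁻) with h | h
      · have : (n : ℝ) * t⁻ ≠ 0 := by positivity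
        rw [min_eq_left h, max_eq_right h, div_mul_eq_mul_div, div_self this]
      · rw [min_eq_right h, max_eq_left h, div_one]
    rw [this]
    simp [hv']
  -- on the range of the negative part
  have hran (y : H) :
      Filter.Tendsto (fun n => f n ((T⁻ : H →L[ℂ] H) y)) Filter.atTop
        (nhds ((T⁻ : H →L[ℂ] H) y)) := by
    have hb (n : ℕ) : ‖f (n + 1) * T⁻ - T⁻‖ ≤ 1 / ((n : ℝ) + 1) := by
      rw [hneg, ← cfc_mul _ _ T (hcf _).continuousOn (by fun_prop),
        ← cfc_sub _ _ T (by fun_prop) (by fun_prop)]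
      refine norm_cfc_le (by positivity) fun t _ => ?_
      have hp : (0 : ℝ) < (n : ℝ) + 1 := by positivity
      push_cast
      rcases le_total 1 (((n : ℝ) + 1) * t⁻) with h | h
      · rw [min_eq_left h]
        simp only [one_mul, sub_self, norm_zero]
        positivity
      · rw [min_eq_right h]
        have h2 : t⁻ ≤ 1 / ((n : ℝ) + 1) := by
          rw [le_div_iff₀ hp]
          linarith
        rw [Real.norm_eq_abs, abs_le]
        have := hn0 t
        constructor <;> nlinarith [mul_nonneg (mul_nonneg hp.le this) this]
    rw [← Filter.tendsto_add_atTop_iff_nat 1, tendsto_iff_norm_sub_tendsto_zero]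
    have h0 : Filter.Tendsto (fun n : ℕ => 1 / ((n : ℝ) + 1) * ‖y‖) Filter.atTop (nhds 0) := by
      simpa using (tendsto_one_div_add_atTop_nhds_zero_nat (𝕜 := ℝ)).mul_const ‖y‖
    refine squeeze_zero (fun _ => norm_nonneg _) (fun n => ?_) h0
    have h1 := ContinuousLinearMap.le_of_opNorm_le _ (hb n) y
    simpa using h1
  -- on `K`
  have hclos (v : H) (hv : v ∈ K) :
      Filter.Tendsto (fun n => f n v) Filter.atTop (nhds v) := by
    rw [Metric.tendsto_atTop]
    intro ε hε
    have hv' : v ∈ closure (Set.range (T⁻ : H →L[ℂ] H)) := hv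
    obtain ⟨_, ⟨y, rfl⟩, hy⟩ := Metric.mem_closure_iff.1 hv' (ε / 3) (by positivity)
    obtain ⟨N, hN⟩ := Metric.tendsto_atTop.1 (hran y) (ε / 3) (by positivity)
    refine ⟨N, fun n hn => ?_⟩
    have h1 : dist (f n v) (f n ((T⁻ : H →L[ℂ] H) y)) ≤ dist v ((T⁻ : H →L[ℂ] H) y) := by
      rw [dist_eq_norm, dist_eq_norm, ← map_sub]
      simpa using ContinuousLinearMap.le_of_opNorm_le _ (hf1 n) (v - (T⁻ : H →L[ℂ] H) y)
    have h2 := hN n hn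
    have h3 := dist_triangle4 (f n v) (f n ((T⁻ : H →L[ℂ] H) y)) ((T⁻ : H →L[ℂ] H) y) v
    rw [dist_comm ((T⁻ : H →L[ℂ] H) y) v] at h3
    linarith
  have hX : Xi T x = K.starProjection x := rfl
  have h1 := hclos (K.starProjection x) (K.starProjection_apply_mem x)
  have h2 : ∀ n, f n x = f n (K.starProjection x) := fun n => by
    have := hker _ (K.sub_starProjection_mem_orthogonal x) n
    rwa [map_sub, sub_eq_zero] at this
  rw [hX]
  exact h1.congr fun n => (h2 n).symm

/-- If `μ` is the spectral measure of the self-adjoint operator `T` at `x`, i.e. the finite measure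
with `∫ f dμ = ⟨x, f(T) x⟩` for all bounded continuous `f`, then `⟨x, Ξ(T) x⟩ = μ((-∞, 0))`. -/
theorem inner_Xi_eq_spectralMeasure (T : H →L[ℂ] H) (hT : IsSelfAdjoint T) (x : H)
    (μ : MeasureTheory.Measure ℝ) [MeasureTheory.IsFiniteMeasure μ]
    (hμ : ∀ f : ℝ → ℝ, Continuous f → (∃ C, ∀ t, |f t| ≤ C) →
      ((∫ t, f t ∂μ : ℝ) : ℂ) = ⟪x, (cfc f T) x⟫_ℂ) :
    ⟪x, Xi T x⟫_ℂ = (μ.real (Set.Iio 0) : ℂ) := by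
  have hn0 (t : ℝ) : 0 ≤ t⁻ := negPart_nonneg t
  have hcf (n : ℕ) : Continuous (fun t : ℝ => min 1 ((n : ℝ) * t⁻)) := by fun_prop
  have hbd (n : ℕ) (t : ℝ) : |min 1 ((n : ℝ) * t⁻)| ≤ 1 := by
    rw [abs_of_nonneg (le_min zero_le_one (mul_nonneg n.cast_nonneg (hn0 t)))]
    exact min_le_left _ _
  have h1 : Filter.Tendsto (fun n : ℕ => ∫ t, min 1 ((n : ℝ) * t⁻) ∂μ) Filter.atTop
      (nhds (∫ t, (Set.Iio (0 : ℝ)).indicator 1 t ∂μ)) := by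
    refine MeasureTheory.tendsto_integral_of_dominated_convergence (fun _ => 1)
      (fun n => (hcf n).aestronglyMeasurable) (MeasureTheory.integrable_const _)
      (fun n => Filter.Eventually.of_forall (hbd n)) (Filter.Eventually.of_forall fun t => ?_)
    by_cases ht : t < 0
    · have h : t⁻ = -t := negPart_of_nonpos ht.le
      obtain ⟨N, hN⟩ := exists_nat_ge (1 / (-t))
      refine tendsto_const_nhds.congr' ?_
      filter_upwards [Filter.eventually_ge_atTop N] with n hn
      have h2 : (1 : ℝ) ≤ n * t⁻ := by
        rw [h, ← div_le_iff₀ (by linarith)]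
        exact hN.trans (by exact_mod_cast hn)
      rw [min_eq_left h2]
      simp [ht]
    · have h : t⁻ = 0 := negPart_of_nonneg (not_lt.1 ht)
      simp [h, ht]
  rw [MeasureTheory.integral_indicator_one measurableSet_Iio] at h1
  have h2 := (Complex.continuous_ofReal.tendsto _).comp h1
  have h3 := (tendsto_const_nhds (x := x)).inner (𝕜 := ℂ) (tendsto_cfc_Xi T hT x)
  refine tendsto_nhds_unique h3 (h2.congr fun n => ?_)
  exact hμ _ (hcf n) ⟨1, hbd n⟩

end

open scoped InnerProductSpace

noncomputable section

variable {H : Type*} [NormedAddCommGroup H] [InnerProductSpace ℂ H] [CompleteSpace H]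

open ENNReal ContinuousLinearMap

/-! ### Hilbert–Schmidt operators -/

/-! Since `B ≥ 0`, spectrum of `S + sB` near zero can only move to the right as `s` grows. `Ξ`
therefore changes its relative dimension only when `S + sB` has a kernel, and that kernel, not in
`Ξ` at `s` itself, was in it just before `s`.

Locally, let `A = S + sB` and let `P` be the projection onto `ker A`. As `S + τB` is invertible and
`B` is compact, the Fredholm alternative makes `P` finite-rank and `A + P` invertible; moreover `ker
A ∩ ker B = 0`. For small `h > 0` the segments from `A + P` to `A + hB` and from `A - P` to `A - hB`
consist of invertible operators (`exists_injective_near`). Along such a segment the trace of the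
difference of the spectral projections vanishes (`hasNuclearTrace_Xi_sub_of_isUnit_segment`). Since
`Ξ(A + P) = Ξ(A)` and `Ξ(A - P) = Ξ(A) + P`, the trace is constant to the right of `s` and larger by
`dim ker A` to the left. Compactness of the parameter interval and additivity give the formula.

Trace invariance has two ingredients. With a uniform spectral gap, the difference of projections is
nuclear and norm-small for small steps (`perturbation_Xi`). Two projections at distance less than
one with nuclear difference are similar, and their difference is a commutator with a nuclear
operator, so it has trace zero (`hasNuclearTrace_sub_of_norm_lt_one`). -/

omit [CompleteSpace H] in
theorem HilbertBasis.tsum_enorm_inner_sq {ι : Type*} (b : HilbertBasis ι ℂ H) (x : H) :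
    ∑' i, ‖⟪b i, x⟫_ℂ‖ₑ ^ 2 = ‖x‖ₑ ^ 2 := by
  have h : HasSum (fun i => ‖⟪b i, x⟫_ℂ‖ ^ 2) (‖x‖ ^ 2) := by
    have := Complex.reCLM.hasSum (b.hasSum_inner_mul_inner x x)
    convert this using 1
    · funext i
      rw [← inner_conj_symm x (b i), mul_comm, Complex.mul_conj, Complex.reCLM_apply,
        Complex.ofReal_re, Complex.normSq_eq_norm_sq]
    · rw [inner_self_eq_norm_sq_to_K]
      simp [← Complex.ofReal_pow]
  have h2 := ENNReal.ofReal_tsum_of_nonneg (fun i => sq_nonneg ‖⟪b i, x⟫_ℂ‖) h.summable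
  rw [h.tsum_eq] at h2
  simpa [ENNReal.ofReal_pow, ofReal_norm] using h2.symm

/-- The square of the Hilbert–Schmidt norm, computed in some orthonormal basis. -/
def hsNormSq (X : H →L[ℂ] H) : ℝ≥0∞ :=
  ∑' i, ‖X ((exists_hilbertBasis ℂ H).choose_spec.choose i)‖ₑ ^ 2

/-- Hilbert–Schmidt operators. -/
def IsHilbertSchmidt (X : H →L[ℂ] H) : Prop := hsNormSq X ≠ ∞

/-- Parseval in `c`, then Tonelli: with values in `ℝ≥0∞` the interchange needs no summability.
Because `b` and `c` are unrelated, applying this twice also yields independence of the basis. -/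
theorem tsum_enorm_sq_eq_adjoint {ι κ : Type*} (b : HilbertBasis ι ℂ H) (c : HilbertBasis κ ℂ H)
    (X : H →L[ℂ] H) : ∑' i, ‖X (b i)‖ₑ ^ 2 = ∑' j, ‖(star X) (c j)‖ₑ ^ 2 := by
  calc ∑' i, ‖X (b i)‖ₑ ^ 2 = ∑' i, ∑' j, ‖⟪c j, X (b i)⟫_ℂ‖ₑ ^ 2 := by
        simp_rw [c.tsum_enorm_inner_sq]
    _ = ∑' j, ∑' i, ‖⟪c j, X (b i)⟫_ℂ‖ₑ ^ 2 := ENNReal.tsum_comm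
    _ = ∑' j, ∑' i, ‖⟪b i, (star X) (c j)⟫_ℂ‖ₑ ^ 2 := by
        congr 1 with j
        congr 1 with i
        rw [star_eq_adjoint, adjoint_inner_right, ← inner_conj_symm, ← ofReal_norm, ← ofReal_norm,
          RCLike.norm_conj]
    _ = _ := by simp_rw [b.tsum_enorm_inner_sq]

theorem hsNormSq_eq {ι : Type*} (b : HilbertBasis ι ℂ H) (X : H →L[ℂ] H) :
    hsNormSq X = ∑' i, ‖X (b i)‖ₑ ^ 2 := by
  rw [hsNormSq, tsum_enorm_sq_eq_adjoint _ b, tsum_enorm_sq_eq_adjoint b b, star_star]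

theorem hsNormSq_star (X : H →L[ℂ] H) : hsNormSq (star X) = hsNormSq X :=
  (tsum_enorm_sq_eq_adjoint _ _ X).symm

theorem hsNormSq_mul_le_left (Z X : H →L[ℂ] H) : hsNormSq (Z * X) ≤ ‖Z‖ₑ ^ 2 * hsNormSq X := by
  rw [hsNormSq, hsNormSq, ← ENNReal.tsum_mul_left]
  refine ENNReal.tsum_le_tsum fun i => ?_
  rw [← mul_pow]
  gcongr
  exact Z.le_opENorm _

theorem hsNormSq_mul_le_right (X Z : H →L[ℂ] H) : hsNormSq (X * Z) ≤ ‖Z‖ₑ ^ 2 * hsNormSq X := by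
  have h := hsNormSq_mul_le_left (star Z) (star X)
  rw [← star_mul, hsNormSq_star, hsNormSq_star] at h
  rwa [← ofReal_norm, norm_star, ofReal_norm] at h

namespace IsHilbertSchmidt

variable {X Y : H →L[ℂ] H}

theorem star (hX : IsHilbertSchmidt X) : IsHilbertSchmidt (star X) := by
  rwa [IsHilbertSchmidt, hsNormSq_star]

theorem mul_left (Z : H →L[ℂ] H) (hX : IsHilbertSchmidt X) : IsHilbertSchmidt (Z * X) :=
  ((hsNormSq_mul_le_left Z X).trans_lt
    (ENNReal.mul_lt_top (by simp) (lt_top_iff_ne_top.2 hX))).ne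

theorem mul_right (Z : H →L[ℂ] H) (hX : IsHilbertSchmidt X) : IsHilbertSchmidt (X * Z) :=
  ((hsNormSq_mul_le_right X Z).trans_lt
    (ENNReal.mul_lt_top (by simp) (lt_top_iff_ne_top.2 hX))).ne

theorem hasSum {ι : Type*} (hX : IsHilbertSchmidt X) (b : HilbertBasis ι ℂ H) :
    HasSum (fun i => ‖X (b i)‖ ^ 2) (hsNormSq X).toReal := by
  have h := hX
  rw [IsHilbertSchmidt, hsNormSq_eq b] at h
  have h1 := ENNReal.hasSum_toReal h
  rw [← ENNReal.tsum_toReal_eq (fun i => by simp), ← hsNormSq_eq b] at h1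
  simpa using h1

theorem of_summable {ι : Type*} (b : HilbertBasis ι ℂ H)
    (h : Summable fun i => ‖X (b i)‖ ^ 2) : IsHilbertSchmidt X := by
  rw [IsHilbertSchmidt, hsNormSq_eq b]
  have := ENNReal.ofReal_tsum_of_nonneg (fun i => sq_nonneg ‖X (b i)‖) h
  simp only [ENNReal.ofReal_pow (norm_nonneg _), ofReal_norm] at this
  rw [← this]
  exact ENNReal.ofReal_ne_top

theorem sum_le (hX : IsHilbertSchmidt X) {n : ℕ} {e : Fin n → H} (he : Orthonormal ℂ e) :
    ∑ i, ‖X (e i)‖ ^ 2 ≤ (hsNormSq X).toReal := by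
  obtain ⟨w, b, hw, hb⟩ := (he.toSubtypeRange).exists_hilbertBasis_extension
  have h1 := hX.hasSum b
  have hinj : Function.Injective (fun i => (⟨e i, hw ⟨i, rfl⟩⟩ : w)) := fun i j hij =>
    he.linearIndependent.injective (by simpa using hij)
  have h2 := sum_le_hasSum (Finset.univ.map ⟨_, hinj⟩) (fun i _ => sq_nonneg _) h1
  simpa [hb] using h2

theorem norm_sq_le (hX : IsHilbertSchmidt X) : ‖X‖ ^ 2 ≤ (hsNormSq X).toReal := by
  have h0 : 0 ≤ (hsNormSq X).toReal := ENNReal.toReal_nonneg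
  refine (Real.le_sqrt (norm_nonneg _) h0).1 (X.opNorm_le_bound (Real.sqrt_nonneg _) fun x => ?_)
  rcases eq_or_ne x 0 with rfl | hx
  · simp
  have hx' : ‖x‖ ≠ 0 := norm_ne_zero_iff.2 hx
  have he : Orthonormal ℂ (fun _ : Fin 1 => ((‖x‖⁻¹ : ℝ) : ℂ) • x) := by
    refine ⟨fun i => ?_, fun i j hij => absurd (Subsingleton.elim i j) hij⟩
    rw [norm_smul, Complex.norm_real, norm_inv, norm_norm, inv_mul_cancel₀ hx']
  have h := hX.sum_le he
  simp only [Finset.univ_unique, Finset.sum_singleton, map_smul, norm_smul, Complex.norm_real,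
    norm_inv, norm_norm] at h
  have h2 := (Real.le_sqrt (by positivity) h0).2 h
  rwa [inv_mul_le_iff₀ (by positivity), mul_comm] at h2

/-- The operator norm is dominated by the Hilbert–Schmidt norm, so the finite-rank truncations `F s`
converge to `X` in norm: the error is a tail of a convergent series. -/
theorem isCompactOperator (hX : IsHilbertSchmidt X) : IsCompactOperator X := by
  classical
  obtain ⟨w, b, -⟩ := exists_hilbertBasis ℂ H
  let F : Finset w → (H →L[ℂ] H) := fun s => ∑ i ∈ s, (innerSL ℂ (b i)).smulRight (X (b i))
  have hF : ∀ s (i : w), F s (b i) = if i ∈ s then X (b i) else 0 := fun s i => by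
    simp [F, sum_apply, orthonormal_iff_ite.1 b.orthonormal]
  have hc : ∀ s, IsCompactOperator (F s) := fun s => by
    refine Finset.sum_induction _ (fun T : H →L[ℂ] H => IsCompactOperator T)
      (fun _ _ h1 h2 => h1.add h2) isCompactOperator_zero fun i _ => ?_
    have h : IsCompactOperator (toSpanSingleton ℂ (X (b i))) :=
      isCompactOperator_of_locallyCompactSpace_rng _
    exact h.comp_clm (innerSL ℂ (b i))
  have hX' := (hX.hasSum b).summable
  have hd : ∀ s i, ‖(X - F s) (b i)‖ ^ 2 = if i ∈ s then 0 else ‖X (b i)‖ ^ 2 := fun s i => by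
    rw [sub_apply, hF]
    split_ifs <;> simp
  have hs : ∀ s, Summable fun i => ‖(X - F s) (b i)‖ ^ 2 := fun s => by
    refine Summable.of_nonneg_of_le (fun _ => sq_nonneg _) (fun i => ?_) hX'
    rw [hd]
    split_ifs
    · positivity
    · rfl
  have hn : ∀ s, ‖X - F s‖ ^ 2 ≤ ∑' i : { i // i ∉ s}, ‖X (b i)‖ ^ 2 := fun s => by
    refine (IsHilbertSchmidt.of_summable b (hs s)).norm_sq_le.trans_eq ?_
    rw [← ((IsHilbertSchmidt.of_summable b (hs s)).hasSum b).tsum_eq,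
      show (∑' i : { i // i ∉ s}, ‖X (b i)‖ ^ 2) = ∑' i : ({i | i ∉ s} : Set w), ‖X (b i)‖ ^ 2
        from rfl, tsum_subtype {i | i ∉ s} (fun i => ‖X (b i)‖ ^ 2)]
    congr 1 with i
    rw [hd]
    by_cases h : i ∈ s <;> simp [h]
  have ht : Filter.Tendsto (fun s => ‖X - F s‖ ^ 2) Filter.atTop (nhds 0) :=
    squeeze_zero (fun _ => sq_nonneg _) hn (_root_.tendsto_tsum_compl_atTop_zero fun i => ‖X (b i)‖ ^ 2)
  have ht2 : Filter.Tendsto F Filter.atTop (nhds X) := by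
    rw [tendsto_iff_norm_sub_tendsto_zero]
    have := ht.sqrt
    simpa [Real.sqrt_sq, norm_sub_rev] using this
  exact isCompactOperator_of_tendsto ht2 (Filter.Eventually.of_forall hc)

end IsHilbertSchmidt

/-! ### Cyclicity of the trace -/

theorem summable_norm_inner {ι : Type*} {X Y : H →L[ℂ] H} (hX : IsHilbertSchmidt X)
    (hY : IsHilbertSchmidt Y) (b : HilbertBasis ι ℂ H) :
    Summable fun i => ‖⟪X (b i), Y (b i)⟫_ℂ‖ := by
  refine Summable.of_nonneg_of_le (fun _ => norm_nonneg _) (fun i => ?_)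
    ((hX.hasSum b).summable.add (hY.hasSum b).summable)
  have := norm_inner_le_norm (𝕜 := ℂ) (X (b i)) (Y (b i))
  nlinarith [sq_nonneg (‖X (b i)‖ - ‖Y (b i)‖), norm_nonneg (X (b i)), norm_nonneg (Y (b i))]

theorem summable_inner_mul {ι : Type*} {X Y : H →L[ℂ] H} (hX : IsHilbertSchmidt X)
    (hY : IsHilbertSchmidt Y) (b : HilbertBasis ι ℂ H) :
    Summable fun i => ⟪b i, (X * Y) (b i)⟫_ℂ := by
  refine Summable.of_norm ((summable_norm_inner hX.star hY b).congr fun i => ?_)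
  rw [star_eq_adjoint, adjoint_inner_left]
  rfl

theorem summable_norm_inner_sq {ι κ : Type*} (b : HilbertBasis ι ℂ H) (c : HilbertBasis κ ℂ H)
    {Z : H →L[ℂ] H} (hZ : IsHilbertSchmidt Z) :
    Summable fun p : ι × κ => ‖⟪c p.2, Z (b p.1)⟫_ℂ‖ ^ 2 := by
  have h : ∑' p : ι × κ, ‖⟪c p.2, Z (b p.1)⟫_ℂ‖ₑ ^ 2 ≠ ∞ := by
    rw [ENNReal.tsum_prod (f := fun i j => ‖⟪c j, Z (b i)⟫_ℂ‖ₑ ^ 2)]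
    simp_rw [c.tsum_enorm_inner_sq]
    rw [← hsNormSq_eq]
    exact hZ
  simpa using ENNReal.summable_toReal h

/-- Both sides are iterated sums of one double series, absolutely convergent by `2|ab| ≤ |a|² +
|b|²` applied to the matrix entries of `X` and `Y`. -/
theorem tsum_inner_mul_comm {ι κ : Type*} {X Y : H →L[ℂ] H} (hX : IsHilbertSchmidt X)
    (hY : IsHilbertSchmidt Y) (b : HilbertBasis ι ℂ H) (c : HilbertBasis κ ℂ H) :
    ∑' i, ⟪b i, (X * Y) (b i)⟫_ℂ = ∑' j, ⟪c j, (Y * X) (c j)⟫_ℂ := by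
  have e1 : ∀ i, ⟪b i, (X * Y) (b i)⟫_ℂ = ∑' j, ⟪b i, X (c j)⟫_ℂ * ⟪c j, Y (b i)⟫_ℂ := fun i => by
    change ⟪b i, X (Y (b i))⟫_ℂ = _
    rw [← adjoint_inner_left, ← c.tsum_inner_mul_inner]
    simp_rw [adjoint_inner_left]
  have e2 : ∀ j, ⟪c j, (Y * X) (c j)⟫_ℂ = ∑' i, ⟪b i, X (c j)⟫_ℂ * ⟪c j, Y (b i)⟫_ℂ := fun j => by
    change ⟪c j, Y (X (c j))⟫_ℂ = _
    rw [← adjoint_inner_left, ← b.tsum_inner_mul_inner]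
    simp_rw [adjoint_inner_left]
    exact tsum_congr fun i => mul_comm _ _
  simp_rw [e1, e2]
  refine Summable.tsum_comm (f := fun j i => ⟪b i, X (c j)⟫_ℂ * ⟪c j, Y (b i)⟫_ℂ) ?_
  have h1 := summable_norm_inner_sq c b hX
  have h2 := (Equiv.prodComm κ ι).summable_iff.2 (summable_norm_inner_sq b c hY)
  refine Summable.of_norm_bounded (h1.add h2) fun p => ?_
  simp only [Function.uncurry, Function.comp_apply, Equiv.prodComm_apply, Prod.swap, norm_mul]
  nlinarith [sq_nonneg (‖⟪b p.2, X (c p.1)⟫_ℂ‖ - ‖⟪c p.1, Y (b p.2)⟫_ℂ‖),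
    norm_nonneg ⟪b p.2, X (c p.1)⟫_ℂ, norm_nonneg ⟪c p.1, Y (b p.2)⟫_ℂ]

/-- The trace of the commutator of a bounded operator and a trace class operator vanishes. -/
theorem hasSum_inner_commutator {ι : Type*} {X Y : H →L[ℂ] H} (hX : IsHilbertSchmidt X)
    (hY : IsHilbertSchmidt Y) (M : H →L[ℂ] H) (b : HilbertBasis ι ℂ H) :
    HasSum (fun i => ⟪b i, (X * Y * M - M * (X * Y)) (b i)⟫_ℂ) 0 := by
  have h1 := (summable_inner_mul hX (hY.mul_right M) b).hasSum
  have h2 := (summable_inner_mul (hX.mul_left M) hY b).hasSum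
  -- Both traces equal that of `Y M X`: cycle `X · (Y M)` and `(M X) · Y`.
  rw [tsum_inner_mul_comm hX (hY.mul_right M) b b, mul_assoc, ← tsum_inner_mul_comm
    (hX.mul_left M) hY b b] at h1
  have h3 := h1.sub h2
  rw [sub_self] at h3
  refine h3.congr_fun fun i => ?_
  rw [sub_apply, inner_sub_right, mul_assoc, mul_assoc]

/-! ### The negative spectral projection -/

theorem Xi_isStarProjection (T : H →L[ℂ] H) : IsStarProjection (Xi T) :=
  isStarProjection_starProjection

theorem negPart_apply_eq_zero_iff (T : H →L[ℂ] H) (x : H) :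
    (T⁻ : H →L[ℂ] H) x = 0 ↔ Xi T x = 0 := by
  rw [Xi, Submodule.starProjection_apply_eq_zero_iff, Submodule.orthogonal_closure,
    ContinuousLinearMap.orthogonal_range]
  have hsa : adjoint (T⁻ : H →L[ℂ] H) = T⁻ := by
    rw [← star_eq_adjoint]
    exact (CFC.negPart_nonneg T).isSelfAdjoint
  rw [hsa]
  rfl

theorem Xi_mul_negPart (T : H →L[ℂ] H) : Xi T * T⁻ = T⁻ := by
  ext x
  exact Submodule.starProjection_eq_self_iff.2 (Submodule.le_topologicalClosure _ ⟨x, rfl⟩)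

/-- An operator that annihilates the range of `T⁻` annihilates `Xi T`. -/
theorem mul_Xi_eq_zero {T Z : H →L[ℂ] H} (h : Z * T⁻ = 0) : Z * Xi T = 0 := by
  ext x
  have hle : (LinearMap.range ((T⁻ : H →L[ℂ] H) : H →ₗ[ℂ] H)).topologicalClosure ≤ Z.ker := by
    refine Submodule.topologicalClosure_minimal _ ?_ Z.isClosed_ker
    rintro _ ⟨y, rfl⟩
    exact congr($h y)
  exact hle (Submodule.starProjection_apply_mem _ x)

theorem posPart_mul_Xi (T : H →L[ℂ] H) : T⁺ * Xi T = 0 :=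
  mul_Xi_eq_zero (CFC.posPart_mul_negPart T)

theorem negPart_mul_Xi (T : H →L[ℂ] H) : T⁻ * Xi T = T⁻ := by
  have h := congr(star $(Xi_mul_negPart T))
  rwa [star_mul, (CFC.negPart_nonneg T).isSelfAdjoint.star_eq,
    (Xi_isStarProjection T).isSelfAdjoint.star_eq] at h

theorem mul_Xi {T : H →L[ℂ] H} (hT : IsSelfAdjoint T) : T * Xi T = -T⁻ := by
  calc T * Xi T = (T⁺ - T⁻) * Xi T := by rw [CFC.posPart_sub_negPart T hT]
    _ = -T⁻ := by rw [sub_mul, posPart_mul_Xi, negPart_mul_Xi, zero_sub]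

theorem commute_Xi {T : H →L[ℂ] H} (hT : IsSelfAdjoint T) : Commute T (Xi T) := by
  have h := congr(star $(mul_Xi hT))
  rw [star_mul, star_neg, (CFC.negPart_nonneg T).isSelfAdjoint.star_eq,
    (Xi_isStarProjection T).isSelfAdjoint.star_eq, hT.star_eq, ← mul_Xi hT] at h
  exact h.symm

/-- The splitting `T = T(1 - E) - (-TE)` has the properties that characterize the positive and
negative parts, so `T⁻ = -TE`. Injectivity of `T` on the range of `E` gives `Ξ(T)` and `E` the same
kernel, and an orthogonal projection is determined by its kernel. -/
theorem Xi_unique {T E : H →L[ℂ] H} (hE : IsStarProjection E) (hc : Commute T E)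
    (hneg : 0 ≤ -(T * E)) (hpos : 0 ≤ T * (1 - E)) (hker : ∀ x, T (E x) = 0 → E x = 0) :
    Xi T = E := by
  have hEE : E * E = E := hE.isIdempotentElem
  have h := CFC.posPart_negPart_unique (a := T) (b := T * (1 - E)) (c := -(T * E))
    (by simp [mul_sub]) (by
      rw [mul_neg, mul_assoc, hc.eq, ← mul_assoc (1 - E), sub_mul, hEE]; simp) hpos hneg
  have hz : ∀ x, Xi T x = 0 ↔ E x = 0 := fun x => by
    rw [← negPart_apply_eq_zero_iff, h.2]
    refine ⟨fun hx => hker x (by simpa using hx), fun hx => by simp [hx]⟩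
  have hX := Xi_isStarProjection T
  have hXX : Xi T * Xi T = Xi T := hX.isIdempotentElem
  have e1 : E * Xi T = E := by
    ext x
    have := (hz (x - Xi T x)).1 (by rw [map_sub, sub_eq_zero]; exact congr($hXX x).symm)
    rw [map_sub, sub_eq_zero] at this
    exact this.symm
  have e2 : Xi T * E = Xi T := by
    ext x
    have := (hz (x - E x)).2 (by rw [map_sub, sub_eq_zero]; exact congr($hEE x).symm)
    rw [map_sub, sub_eq_zero] at this
    exact this.symm
  have e3 := congr(star $e1)
  rw [star_mul, hX.isSelfAdjoint.star_eq, hE.isSelfAdjoint.star_eq] at e3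
  rw [← e2, e3]

theorem mul_eq_zero_symm {A P : H →L[ℂ] H} (hA : IsSelfAdjoint A) (hP : IsSelfAdjoint P)
    (h : A * P = 0) : P * A = 0 := by
  have := congr(star $h)
  rwa [star_mul, hA.star_eq, hP.star_eq, star_zero] at this

/-! ### Shifting an operator by a projection inside its kernel -/

section Kernel

variable {A P : H →L[ℂ] H}

/-- `A⁻A⁻ = -AA⁻` is killed by `P` on the left, and the C*-identity for `P A⁻` removes the square.
-/
theorem mul_negPart_eq_zero (hA : IsSelfAdjoint A) (hP : IsSelfAdjoint P) (h : A * P = 0) :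
    P * A⁻ = 0 := by
  have h1 : P * A = 0 := mul_eq_zero_symm hA hP h
  have h2 : P * (A⁻ * A⁻) = 0 := by
    have : A⁻ * A⁻ = -(A * A⁻) := by
      calc A⁻ * A⁻ = -((A⁺ - A⁻) * A⁻) := by simp [sub_mul, CFC.posPart_mul_negPart]
        _ = -(A * A⁻) := by rw [CFC.posPart_sub_negPart A hA]
    rw [this, mul_neg, ← mul_assoc, h1, zero_mul, neg_zero]
  have h3 : (P * A⁻) * star (P * A⁻) = 0 := by
    rw [star_mul, (CFC.negPart_nonneg A).isSelfAdjoint.star_eq, mul_assoc, ← mul_assoc A⁻,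
      ← mul_assoc, h2, zero_mul]
  exact CStarRing.mul_star_self_eq_zero_iff _ |>.1 h3

variable (hA : IsSelfAdjoint A) (hP : IsStarProjection P) (h : A * P = 0)
include hA hP h

theorem Xi_add_of_mul_eq_zero : Xi (A + P) = Xi A := by
  have hPn := mul_negPart_eq_zero hA hP.isSelfAdjoint h
  have hPX : P * Xi A = 0 := mul_Xi_eq_zero hPn
  have hXP : Xi A * P = 0 :=
    mul_eq_zero_symm hP.isSelfAdjoint (Xi_isStarProjection A).isSelfAdjoint hPX
  have hm : (A + P) * Xi A = -A⁻ := by rw [add_mul, mul_Xi hA, hPX, add_zero]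
  refine Xi_unique (Xi_isStarProjection A) ?_ ?_ ?_ fun x hx => ?_
  · rw [Commute, SemiconjBy, add_mul, mul_add, hPX, hXP, (commute_Xi hA).eq]
  · rw [hm, neg_neg]
    exact CFC.negPart_nonneg A
  · rw [mul_sub, mul_one, hm, sub_neg_eq_add, add_right_comm]
    have : A + A⁻ = A⁺ := by
      conv_lhs => enter [1]; rw [← CFC.posPart_sub_negPart A hA]
      exact sub_add_cancel _ _
    rw [this]
    exact add_nonneg (CFC.posPart_nonneg A) hP.nonneg
  · have h1 : (-A⁻ : H →L[ℂ] H) x = 0 := by rw [← hm]; exact hx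
    exact (negPart_apply_eq_zero_iff A x).1 (by simpa using h1)

/-- Subtracting `P` turns the range of `P`, where `A` vanishes, into an eigenspace for `-1` and
leaves the rest of `A` alone. This is the source of the kernel dimensions in the trace formula. -/
theorem Xi_sub_of_mul_eq_zero : Xi (A - P) = Xi A + P := by
  have hPn := mul_negPart_eq_zero hA hP.isSelfAdjoint h
  have hPX : P * Xi A = 0 := mul_Xi_eq_zero hPn
  have hX := Xi_isStarProjection A
  have hPP : P * P = P := hP.isIdempotentElem
  have hXX : Xi A * Xi A = Xi A := hX.isIdempotentElem
  have hXP : Xi A * P = 0 := mul_eq_zero_symm hP.isSelfAdjoint hX.isSelfAdjoint hPX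
  have hPA : P * A = 0 := mul_eq_zero_symm hA hP.isSelfAdjoint h
  have hm : (A - P) * (Xi A + P) = -(A⁻ + P) := by
    rw [sub_mul, mul_add, mul_add, mul_Xi hA, h, hPX, hPP]
    abel
  refine Xi_unique ⟨?_, hX.isSelfAdjoint.add hP.isSelfAdjoint⟩ ?_ ?_ ?_ fun x hx => ?_
  · rw [IsIdempotentElem, add_mul, mul_add, mul_add, hXX, hXP, hPX, hPP]
    abel
  · rw [Commute, SemiconjBy, sub_mul, mul_add, mul_add, add_mul, mul_sub, mul_sub, h, hPX, hXP,
      hPA, (commute_Xi hA).eq]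
    abel
  · rw [hm, neg_neg]
    exact add_nonneg (CFC.negPart_nonneg A) hP.nonneg
  · rw [mul_sub, mul_one, hm]
    have : A - P - -(A⁻ + P) = A⁺ := by
      conv_lhs => enter [1, 1]; rw [← CFC.posPart_sub_negPart A hA]
      abel
    rw [this]
    exact CFC.posPart_nonneg A
  · have h1 : (A⁻ + P) x = 0 := by
      rw [← neg_eq_zero, ← neg_apply, ← hm]
      exact hx
    have h2 : P x = 0 := by
      have h3 : (P * (A⁻ + P)) x = 0 := by
        change P ((A⁻ + P) x) = 0
        rw [h1, map_zero]
      rwa [mul_add, hPn, hPP, zero_add] at h3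
    rw [add_apply, h2, add_zero] at h1
    rw [add_apply, h2, add_zero]
    exact (negPart_apply_eq_zero_iff A x).1 h1

end Kernel

/-! ### Spectral gap -/

/-- `T` has spectrum outside `(-δ, δ)`. -/
def HasGap (T : H →L[ℂ] H) (δ : ℝ) : Prop := ∀ t ∈ spectrum ℝ T, δ ≤ |t|

-- On a spectrum avoiding `(-δ, δ)` the step function agrees with the ramp `min 1 (t⁻ / δ)`.
omit [CompleteSpace H] in
theorem continuousOn_ite_neg {T : H →L[ℂ] H} {δ : ℝ} (hδ : 0 < δ) (hg : HasGap T δ) :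
    ContinuousOn (fun t : ℝ => if t < 0 then (1 : ℝ) else 0) (spectrum ℝ T) := by
  have hc : Continuous fun t : ℝ => min 1 (t⁻ / δ) := by fun_prop
  refine hc.continuousOn.congr fun t ht => ?_
  have h := hg t ht
  dsimp only
  split_ifs with h0
  · rw [abs_of_neg h0] at h
    rw [negPart_of_nonpos h0.le, min_eq_left]
    rwa [le_div_iff₀ hδ, one_mul]
  · rw [negPart_of_nonneg (not_lt.1 h0)]
    simp

theorem Xi_eq_cfc {T : H →L[ℂ] H} (hT : IsSelfAdjoint T) {δ : ℝ} (hδ : 0 < δ)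
    (hg : HasGap T δ) : Xi T = cfc (fun t : ℝ => if t < 0 then (1 : ℝ) else 0) T := by
  have hc := continuousOn_ite_neg hδ hg
  set f : ℝ → ℝ := fun t => if t < 0 then 1 else 0 with hf
  have hTE : T * cfc f T = cfc (fun t => t * f t) T := by
    conv_lhs => enter [1]; rw [← cfc_id' ℝ T]
    rw [← cfc_mul _ _ T]
  refine Xi_unique ⟨?_, cfc_predicate f T⟩ (Commute.symm (cfc_commute_cfc f id T |> fun h => ?_))
    ?_ ?_ fun x hx => ?_
  · rw [IsIdempotentElem, ← cfc_mul _ _ T]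
    congr 1
    funext t
    simp only [hf]
    split_ifs <;> simp
  · rwa [cfc_id ℝ T] at h
  · rw [hTE, ← cfc_neg]
    refine cfc_nonneg fun t _ => ?_
    simp only [hf]
    split_ifs with h <;> linarith
  · rw [mul_sub, hTE, mul_one]
    conv_rhs => enter [1]; rw [← cfc_id' ℝ T]
    rw [← cfc_sub _ _ T]
    refine cfc_nonneg fun t _ => ?_
    simp only [hf]
    split_ifs with h <;> linarith
  · have hne : ∀ t ∈ spectrum ℝ T, t ≠ 0 := fun t ht h0 => by
      have := hg t ht
      rw [h0, abs_zero] at this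
      linarith
    have hinv : cfc (fun t : ℝ => t⁻¹) T * T = 1 := by
      conv_lhs => enter [2]; rw [← cfc_id' ℝ T]
      rw [← cfc_mul _ _ T (continuousOn_inv₀.mono hne), ← cfc_one ℝ T]
      exact cfc_congr fun t ht => inv_mul_cancel₀ (hne t ht)
    have h2 : (cfc (fun t : ℝ => t⁻¹) T * T) (cfc f T x) = 0 := by
      change cfc (fun t : ℝ => t⁻¹) T (T (cfc f T x)) = 0
      rw [hx, map_zero]
    rwa [hinv] at h2

/-! ### Nuclear operators -/

/-- The sums `∑ |⟨eᵢ, T fᵢ⟩|` over finite orthonormal families are bounded. -/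
def IsNuclear (T : H →L[ℂ] H) : Prop :=
  ∃ C : ℝ, ∀ (n : ℕ) (e f : Fin n → H), Orthonormal ℂ e → Orthonormal ℂ f →
    ∑ i, ‖⟪e i, T (f i)⟫_ℂ‖ ≤ C

/-- The Hilbert–Schmidt norm. -/
def hsNorm (X : H →L[ℂ] H) : ℝ := √(hsNormSq X).toReal

theorem hsNorm_mul_le_left {X : H →L[ℂ] H} (hX : IsHilbertSchmidt X) (Z : H →L[ℂ] H) :
    hsNorm (Z * X) ≤ ‖Z‖ * hsNorm X := by
  rw [hsNorm, hsNorm, ← Real.sqrt_sq (norm_nonneg Z), ← Real.sqrt_mul (sq_nonneg _)]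
  refine Real.sqrt_le_sqrt ?_
  have := ENNReal.toReal_mono (ENNReal.mul_ne_top (by simp) hX) (hsNormSq_mul_le_left Z X)
  simpa using this

theorem hsNorm_star (X : H →L[ℂ] H) : hsNorm (star X) = hsNorm X := by
  rw [hsNorm, hsNorm, hsNormSq_star]

theorem hsNorm_mul_le_right {X : H →L[ℂ] H} (hX : IsHilbertSchmidt X) (Z : H →L[ℂ] H) :
    hsNorm (X * Z) ≤ ‖Z‖ * hsNorm X := by
  have := hsNorm_mul_le_left hX.star (star Z)
  rwa [← star_mul, hsNorm_star, hsNorm_star, norm_star] at this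

theorem sum_norm_inner_mul_le {X Y : H →L[ℂ] H} (hX : IsHilbertSchmidt X)
    (hY : IsHilbertSchmidt Y) {n : ℕ} {e f : Fin n → H} (he : Orthonormal ℂ e)
    (hf : Orthonormal ℂ f) : ∑ i, ‖⟪e i, (X * Y) (f i)⟫_ℂ‖ ≤ hsNorm X * hsNorm Y := by
  calc ∑ i, ‖⟪e i, (X * Y) (f i)⟫_ℂ‖ ≤ ∑ i, ‖(star X) (e i)‖ * ‖Y (f i)‖ := by
        refine Finset.sum_le_sum fun i _ => ?_
        change ‖⟪e i, X (Y (f i))⟫_ℂ‖ ≤ _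
        rw [← adjoint_inner_left]
        exact norm_inner_le_norm _ _
    _ ≤ √(∑ i, ‖(star X) (e i)‖ ^ 2) * √(∑ i, ‖Y (f i)‖ ^ 2) :=
        Real.sum_mul_le_sqrt_mul_sqrt _ _ _
    _ ≤ hsNorm (star X) * hsNorm Y := by
        rw [hsNorm, hsNorm]
        gcongr
        · exact hX.star.sum_le he
        · exact hY.sum_le hf
    _ = _ := by rw [hsNorm_star]

namespace IsNuclear

variable {S T : H →L[ℂ] H}

omit [CompleteSpace H] in
theorem add (hS : IsNuclear S) (hT : IsNuclear T) : IsNuclear (S + T) := by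
  obtain ⟨C, hC⟩ := hS
  obtain ⟨D, hD⟩ := hT
  refine ⟨C + D, fun n e f he hf => le_trans ?_ (add_le_add (hC n e f he hf) (hD n e f he hf))⟩
  rw [← Finset.sum_add_distrib]
  refine Finset.sum_le_sum fun i _ => ?_
  rw [add_apply, inner_add_right]
  exact norm_add_le _ _

omit [CompleteSpace H] in
theorem neg (hT : IsNuclear T) : IsNuclear (-T) := by
  obtain ⟨C, hC⟩ := hT
  refine ⟨C, fun n e f he hf => ?_⟩
  simpa using hC n e f he hf

theorem star (hT : IsNuclear T) : IsNuclear (star T) := by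
  obtain ⟨C, hC⟩ := hT
  refine ⟨C, fun n e f he hf => ?_⟩
  convert hC n f e hf he using 2 with i
  rw [star_eq_adjoint, adjoint_inner_right, ← inner_conj_symm, RCLike.norm_conj]

theorem of_mul {X Y : H →L[ℂ] H} (hX : IsHilbertSchmidt X) (hY : IsHilbertSchmidt Y) :
    IsNuclear (X * Y) :=
  ⟨_, fun _ _ _ he hf => sum_norm_inner_mul_le hX hY he hf⟩

/-- Solutions of `X = R X L + G` with `‖R‖ ‖L‖ < 1` inherit nuclearity from `G`. -/
theorem of_eq_mul_add {X R L F G : H →L[ℂ] H} (hF : IsHilbertSchmidt F) (hG : IsHilbertSchmidt G)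
    (h : X = R * X * L + F * G) (hRL : ‖R‖ * ‖L‖ < 1) : IsNuclear X := by
  set ρ := ‖R‖ * ‖L‖ with hρ
  have hρ0 : 0 ≤ ρ := by positivity
  set C := hsNorm F * hsNorm G with hC
  have hC0 : 0 ≤ C := mul_nonneg (Real.sqrt_nonneg _) (Real.sqrt_nonneg _)
  have hpow : ∀ (Z : H →L[ℂ] H) (N : ℕ), ‖Z ^ N‖ ≤ ‖Z‖ ^ N := fun Z N => by
    rcases N.eq_zero_or_pos with rfl | hN
    · rw [pow_zero, pow_zero]
      exact norm_id_le
    · exact norm_pow_le' Z hN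
  refine ⟨C / (1 - ρ), fun n e f he hf => ?_⟩
  -- Substituting the equation into itself peels off the term `Rᴺ F G Lᴺ`, bounded by `ρᴺ C`
  -- independently of the orthonormal families.
  have step : ∀ N : ℕ, ∑ i, ‖⟪e i, (R ^ N * X * L ^ N) (f i)⟫_ℂ‖ ≤
      ∑ i, ‖⟪e i, (R ^ (N + 1) * X * L ^ (N + 1)) (f i)⟫_ℂ‖ + ρ ^ N * C := fun N => by
    have e1 : R ^ N * X * L ^ N =
        R ^ (N + 1) * X * L ^ (N + 1) + (R ^ N * F) * (G * L ^ N) := by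
      conv_lhs => rw [h]
      rw [pow_succ R, pow_succ' L]
      noncomm_ring
    have e2 : ∑ i, ‖⟪e i, ((R ^ N * F) * (G * L ^ N)) (f i)⟫_ℂ‖ ≤ ρ ^ N * C := by
      refine (sum_norm_inner_mul_le (hF.mul_left _) (hG.mul_right _) he hf).trans ?_
      have h1 := (hsNorm_mul_le_left hF (R ^ N)).trans
        (mul_le_mul_of_nonneg_right (hpow R N) (Real.sqrt_nonneg _))
      have h2 := (hsNorm_mul_le_right hG (L ^ N)).trans
        (mul_le_mul_of_nonneg_right (hpow L N) (Real.sqrt_nonneg _))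
      refine (mul_le_mul h1 h2 (Real.sqrt_nonneg _)
        (mul_nonneg (by positivity) (Real.sqrt_nonneg _))).trans_eq ?_
      rw [hρ, hC, mul_pow]
      ring
    rw [e1]
    refine le_trans ?_ (add_le_add_right e2 _)
    rw [← Finset.sum_add_distrib]
    refine Finset.sum_le_sum fun i _ => ?_
    rw [add_apply, inner_add_right]
    exact norm_add_le _ _
  have hsum : ∀ N : ℕ, ∑ i, ‖⟪e i, X (f i)⟫_ℂ‖ ≤
      ∑ i, ‖⟪e i, (R ^ N * X * L ^ N) (f i)⟫_ℂ‖ + (∑ k ∈ Finset.range N, ρ ^ k) * C := fun N => by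
    induction N with
    | zero => simp
    | succ N ih =>
      have := step N
      rw [Finset.sum_range_succ, add_mul]
      linarith
  -- The remainder is bounded through the operator norm only, hence the factor `n`; it vanishes as
  -- `N → ∞` for fixed `n`, leaving a bound free of `n`.
  have hfin : ∀ N : ℕ, ∑ i, ‖⟪e i, X (f i)⟫_ℂ‖ ≤ ρ ^ N * (n * ‖X‖) + C / (1 - ρ) := fun N => by
    refine (hsum N).trans (add_le_add ?_ ?_)
    · have : ∀ i, ‖⟪e i, (R ^ N * X * L ^ N) (f i)⟫_ℂ‖ ≤ ρ ^ N * ‖X‖ := fun i => by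
        refine (norm_inner_le_norm _ _).trans ?_
        rw [he.1 i, one_mul]
        refine (le_opNorm _ _).trans ?_
        rw [hf.1 i, mul_one]
        refine (norm_mul₃_le).trans ?_
        rw [hρ, mul_pow, mul_right_comm]
        exact mul_le_mul_of_nonneg_right (mul_le_mul (hpow R N) (hpow L N) (norm_nonneg _)
          (by positivity)) (norm_nonneg _)
      refine (Finset.sum_le_sum fun i _ => this i).trans_eq ?_
      simp
      ring
    · rw [div_eq_inv_mul, ← tsum_geometric_of_lt_one hρ0 hRL]
      exact mul_le_mul_of_nonneg_right ((summable_geometric_of_lt_one hρ0 hRL).sum_le_tsum _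
        fun _ _ => by positivity) hC0
  have ht : Filter.Tendsto (fun N : ℕ => ρ ^ N * (n * ‖X‖) + C / (1 - ρ)) Filter.atTop
      (nhds (0 * (n * ‖X‖) + C / (1 - ρ))) :=
    ((tendsto_pow_atTop_nhds_zero_of_lt_one hρ0 hRL).mul_const _).add_const _
  rw [zero_mul, zero_add] at ht
  exact ge_of_tendsto' ht hfin

omit [CompleteSpace H] in
theorem sum_finset_le {C : ℝ} (hC : ∀ (n : ℕ) (e f : Fin n → H), Orthonormal ℂ e →
    Orthonormal ℂ f → ∑ i, ‖⟪e i, T (f i)⟫_ℂ‖ ≤ C) {ι : Type*} {e f : ι → H}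
    (he : Orthonormal ℂ e) (hf : Orthonormal ℂ f) (s : Finset ι) :
    ∑ i ∈ s, ‖⟪e i, T (f i)⟫_ℂ‖ ≤ C := by
  have hinj : Function.Injective (fun k => (s.equivFin.symm k : ι)) :=
    Subtype.val_injective.comp s.equivFin.symm.injective
  refine le_trans (le_of_eq ?_) (hC _ _ _ (he.comp _ hinj) (hf.comp _ hinj))
  rw [← Finset.sum_coe_sort]
  exact (s.equivFin.symm.sum_comp fun i : s => ‖⟪e i, T (f i)⟫_ℂ‖).symm

end IsNuclear

/-! ### Nuclear self-adjoint operators: trace class and factorization -/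

theorem norm_sqrt_apply_sq {T : H →L[ℂ] H} (hT : 0 ≤ T) (x : H) :
    ‖CFC.sqrt T x‖ ^ 2 = (⟪x, T x⟫_ℂ).re := by
  have hsa : adjoint (CFC.sqrt T) = CFC.sqrt T := (CFC.sqrt_nonneg T).isSelfAdjoint.star_eq
  have h : ⟪x, T x⟫_ℂ = ⟪CFC.sqrt T x, CFC.sqrt T x⟫_ℂ := by
    conv_rhs => enter [2]; rw [← hsa]
    rw [adjoint_inner_left]
    conv_lhs => rw [← CFC.sqrt_mul_sqrt_self T hT]
    rfl
  rw [h, inner_self_eq_norm_sq_to_K]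
  simp [← Complex.ofReal_pow]

theorem one_sub_two_Xi_mul_self (T : H →L[ℂ] H) :
    (1 - 2 • Xi T) * (1 - 2 • Xi T) = 1 := by
  have hXX : Xi T * Xi T = Xi T := (Xi_isStarProjection T).isIdempotentElem
  simp only [sub_mul, mul_sub, one_mul, mul_one, smul_mul_assoc, mul_smul_comm, hXX]
  abel

theorem abs_eq_one_sub_two_Xi_mul {T : H →L[ℂ] H} (hT : IsSelfAdjoint T) :
    CFC.abs T = (1 - 2 • Xi T) * T := by
  rw [sub_mul, one_mul, smul_mul_assoc, ← (commute_Xi hT).eq, mul_Xi hT, smul_neg, sub_neg_eq_add,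
    ← CFC.abs_sub_self T hT]
  abel

/-- `|T| = JT` with the self-adjoint unitary `J = 1 - 2Ξ(T)`, so `⟨bᵢ, |T| bᵢ⟩ = ⟨J bᵢ, T bᵢ⟩`, and
`J bᵢ` is again orthonormal. This is why nuclearity allows two different families. -/
theorem IsNuclear.summable_abs {T : H →L[ℂ] H} (hT : IsSelfAdjoint T) (h : IsNuclear T)
    {ι : Type*} (b : HilbertBasis ι ℂ H) :
    Summable fun i => (⟪b i, (CFC.abs T) (b i)⟫_ℂ).re := by
  obtain ⟨C, hC⟩ := h
  have hJ : adjoint (1 - 2 • Xi T : H →L[ℂ] H) = 1 - 2 • Xi T := by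
    rw [← star_eq_adjoint, star_sub, star_one, star_nsmul,
      (Xi_isStarProjection T).isSelfAdjoint.star_eq]
  have ho : Orthonormal ℂ fun i => (1 - 2 • Xi T : H →L[ℂ] H) (b i) := by
    have hb := b.orthonormal
    classical
    rw [orthonormal_iff_ite] at hb ⊢
    intro i j
    rw [← hb i j, ← adjoint_inner_right, hJ]
    congr 1
    exact congr($(one_sub_two_Xi_mul_self T) (b j))
  have hn : ∀ i, 0 ≤ (⟪b i, (CFC.abs T) (b i)⟫_ℂ).re := fun i => by
    rw [← norm_sqrt_apply_sq (CFC.abs_nonneg T)]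
    positivity
  refine summable_of_sum_le hn fun s => le_trans (Finset.sum_le_sum fun i _ => ?_)
    (IsNuclear.sum_finset_le hC ho b.orthonormal s)
  refine (Complex.re_le_norm _).trans_eq ?_
  rw [abs_eq_one_sub_two_Xi_mul hT]
  conv_rhs => rw [← adjoint_inner_right, hJ]
  rfl

theorem IsNuclear.isTraceClass {T : H →L[ℂ] H} (hT : IsSelfAdjoint T) (h : IsNuclear T) :
    IsTraceClass T := by
  obtain ⟨w, b, -⟩ := exists_hilbertBasis ℂ H
  exact ⟨w, b, h.summable_abs hT b⟩

theorem IsHilbertSchmidt.sqrt_of_summable {T : H →L[ℂ] H} (hT : 0 ≤ T) {ι : Type*}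
    (b : HilbertBasis ι ℂ H) (h : Summable fun i => (⟪b i, T (b i)⟫_ℂ).re) :
    IsHilbertSchmidt (CFC.sqrt T) :=
  .of_summable b (by simpa only [norm_sqrt_apply_sq hT] using h)

/-- A self-adjoint nuclear operator is a product of Hilbert–Schmidt operators. -/
theorem IsNuclear.exists_eq_mul {T : H →L[ℂ] H} (hT : IsSelfAdjoint T) (h : IsNuclear T) :
    ∃ X Y : H →L[ℂ] H, IsHilbertSchmidt X ∧ IsHilbertSchmidt Y ∧ T = X * Y := by
  obtain ⟨w, b, -⟩ := exists_hilbertBasis ℂ H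
  have hs := IsHilbertSchmidt.sqrt_of_summable (CFC.abs_nonneg T) b (h.summable_abs hT b)
  refine ⟨_, _, hs.mul_left (1 - 2 • Xi T), hs, ?_⟩
  rw [mul_assoc, CFC.sqrt_mul_sqrt_self _ (CFC.abs_nonneg T), abs_eq_one_sub_two_Xi_mul hT,
    ← mul_assoc, one_sub_two_Xi_mul_self, one_mul]

/-! ### Perturbation of spectral projections -/

theorem abs_le_norm_of_mem_spectrum {T : H →L[ℂ] H} {t : ℝ} (ht : t ∈ spectrum ℝ T) :
    |t| ≤ ‖T‖ := by
  have h := spectrum.norm_le_norm_mul_of_mem ht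
  have h1 : ‖(1 : H →L[ℂ] H)‖ ≤ 1 := norm_id_le
  exact h.trans (mul_le_of_le_one_right (norm_nonneg _) h1)

/-- Neumann series: `t - u = -(1 - t u⁻¹) u` is invertible for `|t| < δ`. -/
theorem HasGap.of_norm_inv {u : (H →L[ℂ] H)ˣ} {δ : ℝ} (hδ : 0 < δ)
    (hu : ‖(↑u⁻¹ : H →L[ℂ] H)‖ ≤ δ⁻¹) : HasGap (u : H →L[ℂ] H) δ := by
  intro t ht
  by_contra! hlt
  refine ht ?_
  change IsUnit (algebraMap ℝ (H →L[ℂ] H) t - u)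
  have h1 : ‖(1 : H →L[ℂ] H)‖ ≤ 1 := norm_id_le
  have hn : ‖algebraMap ℝ (H →L[ℂ] H) t * ↑u⁻¹‖ < 1 := by
    refine (norm_mul_le _ _).trans_lt ?_
    have : ‖algebraMap ℝ (H →L[ℂ] H) t‖ ≤ |t| := by
      rw [norm_algebraMap]
      exact mul_le_of_le_one_right (norm_nonneg _) h1
    calc _ ≤ |t| * δ⁻¹ := mul_le_mul this hu (norm_nonneg _) (abs_nonneg _)
      _ < δ * δ⁻¹ := mul_lt_mul_of_pos_right hlt (inv_pos.2 hδ)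
      _ = 1 := mul_inv_cancel₀ hδ.ne'
  have h2 := ((isUnit_one_sub_of_norm_lt_one hn).mul u.isUnit).neg
  convert h2 using 1
  rw [sub_mul, one_mul, mul_assoc, Units.inv_mul, mul_one, neg_sub]

/-- `X = (1 - Q)P` solves the Sylvester equation `A'X - XA = (1 - Q)(A' - A)P`. After a shift by
`c`, `A' + c ≥ c + δ` on the range of `1 - Q` and `0 ≤ A + c ≤ c - δ` on that of `P`; dividing by
`A' + c` makes it a fixed-point equation `X = R X L + R(A' - A)P` with `‖R‖‖L‖ ≤ (c - δ)/(c + δ) <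
1`. -/
theorem perturbation_one_sub_Xi_mul_Xi {A A' F G : H →L[ℂ] H} (hA : IsSelfAdjoint A)
    (hA' : IsSelfAdjoint A') (hF : IsHilbertSchmidt F) (hG : IsHilbertSchmidt G)
    (hD : A' - A = F * G) {δ : ℝ} (hδ : 0 < δ) (hg : HasGap A δ) (hg' : HasGap A' δ) :
    IsNuclear ((1 - Xi A') * Xi A) ∧ 2 * δ * ‖(1 - Xi A') * Xi A‖ ≤ ‖A' - A‖ := by
  set P := Xi A with hP
  set Q := Xi A' with hQ
  set f : ℝ → ℝ := fun t => if t < 0 then 1 else 0 with hf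
  set c := ‖A‖ + ‖A'‖ + δ with hc
  have hc1 : ∀ t ∈ spectrum ℝ A, |t| ≤ c - δ := fun t ht => by
    have := abs_le_norm_of_mem_spectrum ht
    have := norm_nonneg A'
    linarith
  have hc2 : ∀ t ∈ spectrum ℝ A', |t| ≤ c - δ := fun t ht => by
    have := abs_le_norm_of_mem_spectrum ht
    have := norm_nonneg A
    linarith
  have hcδ : δ ≤ c := by
    have := norm_nonneg A
    have := norm_nonneg A'
    linarith
  have hfc := continuousOn_ite_neg hδ hg
  have hfc' := continuousOn_ite_neg hδ hg'
  have hP' : P = cfc f A := Xi_eq_cfc hA hδ hg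
  have hQ' : Q = cfc f A' := Xi_eq_cfc hA' hδ hg'
  have hpos : ∀ t ∈ spectrum ℝ A', 0 < t + c := fun t ht => by
    have := (abs_le.1 (hc2 t ht)).1
    linarith
  have hRc : ContinuousOn (fun t => (1 - f t) / (t + c)) (spectrum ℝ A') :=
    (continuousOn_const.sub hfc').div (by fun_prop) fun t ht => (hpos t ht).ne'
  set R := cfc (fun t => (1 - f t) / (t + c)) A' with hR
  set L := cfc (fun t => (t + c) * f t) A with hL
  set k : H →L[ℂ] H := algebraMap ℝ (H →L[ℂ] H) c with hk
  have hRn : ‖R‖ ≤ (c + δ)⁻¹ := by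
    refine norm_cfc_le (by positivity) fun t ht => ?_
    have h0 := hpos t ht
    have h1 := hg' t ht
    simp only [hf]
    split_ifs with h
    · simp
      positivity
    · rw [abs_of_nonneg (not_lt.1 h)] at h1
      rw [sub_zero, one_div, norm_inv, Real.norm_of_nonneg h0.le]
      exact inv_anti₀ (by positivity) (by linarith)
  have hLn : ‖L‖ ≤ c - δ := by
    refine norm_cfc_le (by linarith) fun t ht => ?_
    have h0 := abs_le.1 (hc1 t ht)
    have h1 := hg t ht
    simp only [hf]
    split_ifs with h
    · rw [abs_of_neg h] at h1
      rw [mul_one, Real.norm_of_nonneg (by linarith)]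
      linarith
    · simp
      linarith
  have hPP : P * P = P := (Xi_isStarProjection A).isIdempotentElem
  have hQQ : Q * Q = Q := (Xi_isStarProjection A').isIdempotentElem
  have hLeq : L = (A + k) * P := by
    rw [hL, cfc_mul (fun t => t + c) f A (by fun_prop) hfc, cfc_add_const c (fun t => t) A,
      cfc_id' ℝ A, hP']
  have hReq : R * (A' + k) = 1 - Q := by
    have e1 : A' + k = cfc (fun t => t + c) A' := by
      rw [cfc_add_const c (fun t => t) A', cfc_id' ℝ A']
    rw [e1, ← cfc_mul _ _ A' hRc (by fun_prop), hQ', ← cfc_one ℝ A', ← cfc_sub _ _ A']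
    exact cfc_congr fun t ht => div_mul_cancel₀ _ (hpos t ht).ne'
  have hRQ : R * (1 - Q) = R := by
    rw [hQ', ← cfc_one ℝ A', ← cfc_sub _ _ A', ← cfc_mul _ _ A' hRc (by fun_prop)]
    congr 1
    funext t
    simp only [hf, Pi.one_apply]
    split_ifs <;> simp
  have hPL : P * L = L := by
    rw [hP', ← cfc_mul _ _ A hfc (by fun_prop)]
    congr 1
    funext t
    simp only [hf]
    split_ifs <;> simp
  have hcomm : (A' + k) * (1 - Q) = (1 - Q) * (A' + k) := by
    have h1 : A' * Q = Q * A' := (commute_Xi hA').eq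
    have h2 : k * Q = Q * k := Algebra.commutes _ _
    simp only [add_mul, mul_sub, sub_mul, mul_add, h1, h2, one_mul, mul_one]
    abel
  have hidem : (1 - Q) * (1 - Q) = 1 - Q := by
    simp only [sub_mul, mul_sub, one_mul, mul_one, hQQ]
    abel
  have hX : (1 - Q) * P = R * ((1 - Q) * P) * L + R * (A' - A) * P := by
    calc (1 - Q) * P = R * (A' + k) * ((1 - Q) * P) := by rw [hReq, ← mul_assoc, hidem]
      _ = R * ((1 - Q) * ((A + k) * P)) + R * ((1 - Q) * ((A' - A) * P)) := by
          rw [mul_assoc R, ← mul_assoc (A' + k), hcomm]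
          noncomm_ring
      _ = R * ((1 - Q) * P) * L + R * (A' - A) * P := by
          rw [← hLeq, mul_assoc R, mul_assoc (1 - Q), hPL, ← mul_assoc R (1 - Q) (_ * P), hRQ,
            ← mul_assoc R (A' - A)]
  have hρ : ‖R‖ * ‖L‖ ≤ (c + δ)⁻¹ * (c - δ) :=
    mul_le_mul hRn hLn (norm_nonneg _) (by positivity)
  constructor
  · refine IsNuclear.of_eq_mul_add (hF.mul_left R) (hG.mul_right P)
      (by rw [mul_assoc R F, ← mul_assoc F, ← hD, ← mul_assoc]; exact hX) (hρ.trans_lt ?_)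
    rw [inv_mul_lt_one₀ (by positivity)]
    linarith
  · have h1 : ‖(1 - Q) * P‖ ≤
        (c + δ)⁻¹ * (c - δ) * ‖(1 - Q) * P‖ + (c + δ)⁻¹ * ‖A' - A‖ := by
      conv_lhs => rw [hX]
      refine (norm_add_le _ _).trans (add_le_add ?_ ?_)
      · refine (norm_mul₃_le).trans ?_
        rw [mul_right_comm]
        exact mul_le_mul_of_nonneg_right hρ (norm_nonneg _)
      · refine (norm_mul₃_le).trans ?_
        have hPn : ‖P‖ ≤ 1 := IsStarProjection.norm_le _ (Xi_isStarProjection A)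
        exact (mul_le_of_le_one_right (by positivity) hPn).trans
          (mul_le_mul_of_nonneg_right hRn (norm_nonneg _))
    have h2 : (c + δ) * (c + δ)⁻¹ = 1 := mul_inv_cancel₀ (by positivity)
    have h3 := mul_le_mul_of_nonneg_left h1 (show 0 ≤ c + δ by positivity)
    have h4 : (c + δ) * ((c + δ)⁻¹ * (c - δ) * ‖(1 - Q) * P‖ + (c + δ)⁻¹ * ‖A' - A‖) =
        ((c + δ) * (c + δ)⁻¹) * ((c - δ) * ‖(1 - Q) * P‖ + ‖A' - A‖) := by ring
    rw [h4, h2] at h3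
    linarith

theorem perturbation_Xi {A A' F G : H →L[ℂ] H} (hA : IsSelfAdjoint A)
    (hA' : IsSelfAdjoint A') (hF : IsHilbertSchmidt F) (hG : IsHilbertSchmidt G)
    (hD : A' - A = F * G) {δ : ℝ} (hδ : 0 < δ) (hg : HasGap A δ) (hg' : HasGap A' δ) :
    IsNuclear (Xi A' - Xi A) ∧ δ * ‖Xi A' - Xi A‖ ≤ ‖A' - A‖ := by
  obtain ⟨h1, h2⟩ := perturbation_one_sub_Xi_mul_Xi hA hA' hF hG hD hδ hg hg'
  obtain ⟨h3, h4⟩ := perturbation_one_sub_Xi_mul_Xi hA' hA (hF.mul_left (-1)) hG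
    (by rw [mul_assoc, ← hD]; simp) hδ hg' hg
  -- `Q - P = Q(1 - P) - (1 - Q)P`; the two halves, each with constant `2δ`, add up to the constant
  -- `δ`.
  have e : Xi A' - Xi A = star ((1 - Xi A) * Xi A') + -((1 - Xi A') * Xi A) := by
    rw [star_mul, star_sub, star_one, (Xi_isStarProjection A).isSelfAdjoint.star_eq,
      (Xi_isStarProjection A').isSelfAdjoint.star_eq]
    noncomm_ring
  refine ⟨e ▸ h3.star.add h1.neg, ?_⟩
  have h5 : ‖Xi A' - Xi A‖ ≤ ‖(1 - Xi A) * Xi A'‖ + ‖(1 - Xi A') * Xi A‖ := by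
    rw [e]
    exact (norm_add_le _ _).trans_eq (by rw [norm_star, norm_neg])
  rw [norm_sub_rev] at h4
  nlinarith

/-- `T` is self-adjoint and nuclear, with trace `c` in every orthonormal basis. -/
structure HasNuclearTrace (T : H →L[ℂ] H) (c : ℂ) : Prop where
  isSelfAdjoint : IsSelfAdjoint T
  isNuclear : IsNuclear T
  hasSum : ∀ (w : Set H) (b : HilbertBasis w ℂ H), HasSum (fun i : w => ⟪b i, T (b i)⟫_ℂ) c

namespace HasNuclearTrace

variable {S T : H →L[ℂ] H} {c d : ℂ}

theorem hasTrace (h : HasNuclearTrace T c) : HasTrace T c :=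
  ⟨h.isNuclear.isTraceClass h.isSelfAdjoint, h.hasSum⟩

theorem add (hS : HasNuclearTrace S c) (hT : HasNuclearTrace T d) :
    HasNuclearTrace (S + T) (c + d) :=
  ⟨hS.isSelfAdjoint.add hT.isSelfAdjoint, hS.isNuclear.add hT.isNuclear, fun w b => by
    simpa only [add_apply, inner_add_right] using (hS.hasSum w b).add (hT.hasSum w b)⟩

theorem neg (hT : HasNuclearTrace T c) : HasNuclearTrace (-T) (-c) :=
  ⟨hT.isSelfAdjoint.neg, hT.isNuclear.neg, fun w b => by
    simpa only [neg_apply, inner_neg_right] using (hT.hasSum w b).neg⟩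

end HasNuclearTrace

/-- `u = 1 + V` is invertible, because `1 - 2Q` is unitary and so `‖V‖ < 1`, and it intertwines `P`
and `Q`. Hence `Q - P = uPu⁻¹ - P` is the commutator of `V` with `Pu⁻¹`, where `V` is a product of
Hilbert–Schmidt operators. -/
theorem hasNuclearTrace_sub_of_norm_lt_one {P Q : H →L[ℂ] H} (hP : IsStarProjection P)
    (hQ : IsStarProjection Q) (hn : IsNuclear (Q - P)) (h1 : ‖Q - P‖ < 1) :
    HasNuclearTrace (Q - P) 0 := by
  have hsa : IsSelfAdjoint (Q - P) := hQ.isSelfAdjoint.sub hP.isSelfAdjoint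
  refine ⟨hsa, hn, fun w b => ?_⟩
  have hPP : P * P = P := hP.isIdempotentElem
  have hQQ : Q * Q = Q := hQ.isIdempotentElem
  obtain ⟨X, Y, hX, hY, hXY⟩ := hn.exists_eq_mul hsa
  set V : H →L[ℂ] H := (1 - 2 • Q) * (Q - P) with hV
  have hVn : ‖V‖ ≤ ‖Q - P‖ := by
    have hU : star (1 - 2 • Q : H →L[ℂ] H) * (1 - 2 • Q) = 1 := by
      rw [star_sub, star_one, star_nsmul, hQ.isSelfAdjoint.star_eq]
      simp only [sub_mul, mul_sub, one_mul, mul_one, smul_mul_assoc, mul_smul_comm, hQQ]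
      abel
    have h2 := CStarRing.norm_star_mul_self (x := (1 - 2 • Q : H →L[ℂ] H))
    rw [hU] at h2
    have h3 : ‖(1 : H →L[ℂ] H)‖ ≤ 1 := norm_id_le
    refine (norm_mul_le _ _).trans (mul_le_of_le_one_left (norm_nonneg _) ?_)
    nlinarith [norm_nonneg (1 - 2 • Q : H →L[ℂ] H)]
  obtain ⟨u, hu⟩ : IsUnit (1 + V) := by
    have : ‖-V‖ < 1 := by rw [norm_neg]; exact hVn.trans_lt h1
    simpa using isUnit_one_sub_of_norm_lt_one this
  -- Expanded, `1 + V = QP + (1 - Q)(1 - P)`.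
  have hW : (1 + V) * P = Q * (1 + V) := by
    rw [hV]
    simp only [sub_mul, mul_sub, one_mul, mul_one, smul_mul_assoc, mul_add, add_mul, mul_assoc,
      mul_smul_comm, hPP, ← mul_assoc Q Q, hQQ]
    abel
  have hVu : V * (↑u⁻¹ : H →L[ℂ] H) = ↑u⁻¹ * V := by
    have : (u : H →L[ℂ] H) * V = V * u := by rw [hu]; noncomm_ring
    have h2 := congr((↑u⁻¹ : H →L[ℂ] H) * $this * ↑u⁻¹)
    simpa [mul_assoc] using h2
  have hQP : Q - P = V * (P * ↑u⁻¹) - (P * ↑u⁻¹) * V := by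
    have e1 : Q = (1 + V) * P * ↑u⁻¹ := by rw [hW, ← hu, mul_assoc, Units.mul_inv, mul_one]
    have e2 : P = P * (1 + V) * ↑u⁻¹ := by rw [← hu, mul_assoc, Units.mul_inv, mul_one]
    calc Q - P = (1 + V) * P * ↑u⁻¹ - P * (1 + V) * ↑u⁻¹ := by rw [← e1, ← e2]
      _ = V * P * ↑u⁻¹ - P * (V * ↑u⁻¹) := by noncomm_ring
      _ = _ := by rw [hVu, mul_assoc V, mul_assoc P]
  have hVXY : V = ((1 - 2 • Q) * X) * Y := by rw [hV, hXY, mul_assoc]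
  rw [hQP, hVXY]
  exact hasSum_inner_commutator (hX.mul_left _) hY _ b

/-- Inversion is continuous, so the inverses are bounded on the compact segment, and a bound on the
inverse is a gap. -/
theorem exists_hasGap_segment {A D : H →L[ℂ] H}
    (hu : ∀ t ∈ Set.Icc (0 : ℝ) 1, IsUnit (A + t • D)) :
    ∃ δ > 0, ∀ t ∈ Set.Icc (0 : ℝ) 1, HasGap (A + t • D) δ := by
  have hcont : ContinuousOn (fun t : ℝ => Ring.inverse (A + t • D)) (Set.Icc 0 1) := by
    intro t ht
    obtain ⟨u, hu⟩ := hu t ht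
    refine ContinuousAt.continuousWithinAt ?_
    have h1 := NormedRing.inverse_continuousAt u
    rw [hu] at h1
    exact ContinuousAt.comp (f := fun t : ℝ => A + t • D) h1 (by fun_prop)
  obtain ⟨C, hC⟩ := isCompact_Icc.exists_bound_of_continuousOn hcont
  refine ⟨(|C| + 1)⁻¹, by positivity, fun t ht => ?_⟩
  obtain ⟨u, hu'⟩ := hu t ht
  have h1 := hC t ht
  rw [← hu', Ring.inverse_unit] at h1
  rw [← hu']
  have h2 : ‖(↑u⁻¹ : H →L[ℂ] H)‖ ≤ ((|C| + 1)⁻¹)⁻¹ := by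
    rw [inv_inv]
    linarith [le_abs_self C]
  exact HasGap.of_norm_inv (by positivity) h2

/-- The trace of `Xi A' - Xi A` vanishes if `A` and `A'` are joined by a segment of invertible
operators. -/
theorem hasNuclearTrace_Xi_sub_of_isUnit_segment {A F G : H →L[ℂ] H} (hA : IsSelfAdjoint A)
    (hFG : IsSelfAdjoint (F * G)) (hF : IsHilbertSchmidt F) (hG : IsHilbertSchmidt G)
    (hu : ∀ t ∈ Set.Icc (0 : ℝ) 1, IsUnit (A + t • (F * G))) :
    HasNuclearTrace (Xi (A + F * G) - Xi A) 0 := by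
  obtain ⟨δ, hδ0, hgap⟩ := exists_hasGap_segment hu
  have hsa : ∀ t : ℝ, IsSelfAdjoint (A + t • (F * G)) := fun t => by
    rw [IsSelfAdjoint, star_add, hA.star_eq, star_smul, hFG.star_eq, star_trivial]
  -- With `N` equal steps each increment has norm below `δ`, so consecutive projections are at
  -- distance less than one.
  obtain ⟨N, hN⟩ := exists_nat_gt (‖F * G‖ / δ)
  have hN0 : (0 : ℝ) < N := lt_of_le_of_lt (by positivity) hN
  have key : ∀ k : ℕ, k ≤ N →
      HasNuclearTrace (Xi (A + ((k : ℝ) / N) • (F * G)) - Xi A) 0 := by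
    intro k
    induction k with
    | zero =>
      intro _
      simp only [Nat.cast_zero, zero_div, zero_smul, add_zero, sub_self]
      exact ⟨.zero _, ⟨0, by simp⟩, fun w b => by simp⟩
    | succ k ih =>
      intro hk
      have hk' : (k : ℝ) + 1 ≤ N := by exact_mod_cast hk
      have m1 : (k : ℝ) / N ∈ Set.Icc (0 : ℝ) 1 :=
        ⟨by positivity, (div_le_one hN0).2 (by linarith)⟩
      have m2 : ((k + 1 : ℕ) : ℝ) / N ∈ Set.Icc (0 : ℝ) 1 :=
        ⟨by positivity, (div_le_one hN0).2 (by exact_mod_cast hk)⟩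
      have hd : (A + (((k + 1 : ℕ) : ℝ) / N) • (F * G)) - (A + ((k : ℝ) / N) • (F * G)) =
          (N : ℝ)⁻¹ • (F * G) := by
        rw [add_sub_add_left_eq_sub, ← sub_smul]
        congr 1
        push_cast
        ring
      have hd' : (N : ℝ)⁻¹ • (F * G) = ((N : ℝ)⁻¹ • (1 : H →L[ℂ] H)) * F * G := by
        simp
      obtain ⟨hn, hb⟩ := perturbation_Xi (hsa _) (hsa _) (hF.mul_left _) hG (hd.trans hd') hδ0
        (hgap _ m1) (hgap _ m2)
      have hlt : ‖Xi (A + (((k + 1 : ℕ) : ℝ) / N) • (F * G)) -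
          Xi (A + ((k : ℝ) / N) • (F * G))‖ < 1 := by
        rw [hd, norm_smul, norm_inv, Real.norm_of_nonneg hN0.le] at hb
        rw [div_lt_iff₀ hδ0] at hN
        have : (N : ℝ)⁻¹ * ‖F * G‖ < δ := by
          rw [inv_mul_lt_iff₀ hN0]
          exact hN
        by_contra! hcon
        nlinarith
      have h := (ih (by omega)).add (hasNuclearTrace_sub_of_norm_lt_one (Xi_isStarProjection _)
        (Xi_isStarProjection _) hn hlt)
      rw [add_zero] at h
      convert h using 1
      abel
  have h := key N le_rfl
  rwa [div_self hN0.ne', one_smul] at h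

/-! ### Compact perturbations of invertible operators -/

omit [CompleteSpace H] in
theorem isCompactOperator_inv_mul (u : (H →L[ℂ] H)ˣ) {C : H →L[ℂ] H} (hC : IsCompactOperator C) :
    IsCompactOperator (-(↑u⁻¹ * C) : H →L[ℂ] H) :=
  (hC.clm_comp (↑u⁻¹ : H →L[ℂ] H)).neg

omit [CompleteSpace H] in
theorem inv_mul_add_apply (u : (H →L[ℂ] H)ˣ) (C : H →L[ℂ] H) (x : H) :
    (↑u⁻¹ : H →L[ℂ] H) ((u + C) x) = x + (↑u⁻¹ * C : H →L[ℂ] H) x := by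
  have h : (↑u⁻¹ : H →L[ℂ] H) * (u + C) = 1 + ↑u⁻¹ * C := by rw [mul_add, Units.inv_mul]
  exact congr($h x)

/-- Fredholm alternative. -/
theorem isUnit_add_of_isCompactOperator {T C : H →L[ℂ] H} (hT : IsUnit T)
    (hC : IsCompactOperator C) (hinj : ∀ x, (T + C) x = 0 → x = 0) : IsUnit (T + C) := by
  obtain ⟨u, rfl⟩ := hT
  rcases (isCompactOperator_inv_mul u hC).hasEigenvalue_or_mem_resolventSet one_ne_zero with h | h
  · obtain ⟨v, hv, hv0⟩ := h.exists_hasEigenvector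
    refine absurd (hinj v ?_) hv0
    rw [Module.End.mem_eigenspace_iff, one_smul] at hv
    have h1 : (↑u⁻¹ : H →L[ℂ] H) ((u + C) v) = 0 := by
      rw [inv_mul_add_apply]
      nth_rw 1 [← hv]
      exact neg_add_cancel _
    have h2 : ((u : H →L[ℂ] H) * ↑u⁻¹) ((u + C) v) = 0 := by
      change (u : H →L[ℂ] H) ((↑u⁻¹ : H →L[ℂ] H) ((u + C) v)) = 0
      rw [h1, map_zero]
    rwa [Units.mul_inv] at h2
  · have h1 : IsUnit (1 - -(↑u⁻¹ * C) : H →L[ℂ] H) := by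
      simpa [spectrum.mem_resolventSet_iff] using h
    have h2 := u.isUnit.mul h1
    rwa [sub_neg_eq_add, mul_add, mul_one, Units.mul_inv_cancel_left] at h2

theorem finiteDimensional_ker_add {T C : H →L[ℂ] H} (hT : IsUnit T)
    (hC : IsCompactOperator C) : FiniteDimensional ℂ (T + C).ker := by
  obtain ⟨u, rfl⟩ := hT
  have := finite_dimensional_eigenspace (isCompactOperator_inv_mul u hC) 1 one_ne_zero
  refine Submodule.finiteDimensional_of_le (S₂ := Module.End.eigenspace
    ((-(↑u⁻¹ * C) : H →L[ℂ] H) : H →ₗ[ℂ] H) 1) fun x hx => ?_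
  have h := inv_mul_add_apply u C x
  have hx0 : (u + C) x = 0 := hx
  rw [hx0, map_zero] at h
  rw [Module.End.mem_eigenspace_iff, one_smul]
  exact (eq_neg_of_add_eq_zero_left h.symm).symm

omit [CompleteSpace H] in
theorem hasSum_inner_starProjection (N : Submodule ℂ H) [FiniteDimensional ℂ N] {ι : Type*}
    (b : HilbertBasis ι ℂ H) :
    HasSum (fun i => ⟪b i, N.starProjection (b i)⟫_ℂ) (Module.finrank ℂ N) := by
  set v := stdOrthonormalBasis ℂ N
  have e : ∀ i, ⟪b i, N.starProjection (b i)⟫_ℂ = ∑ j, ⟪(v j : H), b i⟫_ℂ * ⟪b i, (v j : H)⟫_ℂ :=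
    fun i => by
      rw [v.starProjection_eq_sum_rankOne]
      simp only [sum_apply, inner_sum, InnerProductSpace.rankOne_apply, inner_smul_right]
  simp_rw [e]
  have h := hasSum_sum (s := Finset.univ) fun j _ => b.hasSum_inner_mul_inner (v j : H) (v j)
  have hj : ∑ j, ⟪(v j : H), (v j : H)⟫_ℂ = Module.finrank ℂ N := by
    have h1 : ∀ j, ⟪(v j : H), (v j : H)⟫_ℂ = 1 := fun j => by
      have : ‖(v j : H)‖ = 1 := v.orthonormal.1 j
      rw [inner_self_eq_norm_sq_to_K, this]
      simp
    simp_rw [h1]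
    simp
  rw [hj] at h
  exact h

theorem norm_apply_sq_of_isStarProjection {P : H →L[ℂ] H} (hP : IsStarProjection P) (x : H) :
    ‖P x‖ ^ 2 = (⟪x, P x⟫_ℂ).re := by
  have hsa : adjoint P = P := hP.isSelfAdjoint.star_eq
  have hPP : P * P = P := hP.isIdempotentElem
  have h : ⟪x, P x⟫_ℂ = ⟪P x, P x⟫_ℂ := by
    conv_rhs => enter [2]; rw [← hsa]
    rw [adjoint_inner_left]
    exact congr(⟪x, $hPP x⟫_ℂ).symm
  rw [h, inner_self_eq_norm_sq_to_K]
  simp [← Complex.ofReal_pow]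

theorem isHilbertSchmidt_starProjection (N : Submodule ℂ H) [FiniteDimensional ℂ N] :
    IsHilbertSchmidt N.starProjection := by
  obtain ⟨w, b, -⟩ := exists_hilbertBasis ℂ H
  refine .of_summable b ?_
  simp_rw [norm_apply_sq_of_isStarProjection isStarProjection_starProjection]
  exact (Complex.reCLM.hasSum (hasSum_inner_starProjection N b)).summable

theorem hasNuclearTrace_starProjection (N : Submodule ℂ H) [FiniteDimensional ℂ N] :
    HasNuclearTrace N.starProjection (Module.finrank ℂ N) where
  isSelfAdjoint := isStarProjection_starProjection.isSelfAdjoint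
  isNuclear := by
    have h := isHilbertSchmidt_starProjection N
    have hP : IsStarProjection N.starProjection := isStarProjection_starProjection
    rw [← hP.isIdempotentElem.eq]
    exact .of_mul h h
  hasSum _ b := hasSum_inner_starProjection N b

/-! ### Crossing of the kernel -/

/-- For small `h ≥ 0` and all `d ≥ 0`, not both zero, `A ± (h B + d P)` is injective, where `P`
is the projection onto the kernel of `A`. -/
theorem exists_injective_near {A B P : H →L[ℂ] H} (hA : IsSelfAdjoint A) (hB : 0 ≤ B)
    (hP : IsStarProjection P) (hAP : A * P = 0) (hu : IsUnit (A + P))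
    (hker : ∀ x, A x = 0 → B x = 0 → x = 0) :
    ∃ ε > (0 : ℝ), ∀ h d : ℝ, 0 ≤ h → h < ε → 0 ≤ d → (0 < h ∨ 0 < d) → ∀ x,
      (A x = h • B x + d • P x ∨ A x = -(h • B x + d • P x)) → x = 0 := by
  obtain ⟨u, hu⟩ := hu
  set C := ‖(↑u⁻¹ : H →L[ℂ] H)‖ with hC
  set K := CFC.sqrt B with hK
  have hBK : ∀ x, B x = K (K x) := fun x => by
    conv_lhs => rw [← CFC.sqrt_mul_sqrt_self B hB]
    rfl
  have hPA := mul_eq_zero_symm hA hP.isSelfAdjoint hAP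
  have hPAx : ∀ x, P (A x) = 0 := fun x => congr($hPA x)
  have hPP : ∀ x, P (P x) = P x := fun x => congr($(hP.isIdempotentElem.eq) x)
  -- This choice gives `h C ‖K‖² < 1`, which lets the linear form value `h‖Kx‖² + d‖Px‖²` absorb its
  -- quadratic upper bound `C h² ‖K‖² ‖Kx‖²`.
  refine ⟨1 / (C * ‖K‖ ^ 2 + 1), by positivity, fun h d hh hε hd hpos x hx => ?_⟩
  rw [lt_div_iff₀ (by positivity)] at hε
  have hq : (⟪x, B x⟫_ℂ).re = ‖K x‖ ^ 2 := (norm_sqrt_apply_sq hB x).symm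
  have hp : (⟪x, P x⟫_ℂ).re = ‖P x‖ ^ 2 := (norm_apply_sq_of_isStarProjection hP x).symm
  have hBx : ‖B x‖ ≤ ‖K‖ * ‖K x‖ := by
    rw [hBK]
    exact K.le_opNorm _
  have h1P : ∀ y, ‖y - P y‖ ≤ ‖y‖ := fun y => by
    have h1 := (1 - P).le_of_opNorm_le (IsStarProjection.norm_le _ hP.one_sub) y
    simpa using h1
  -- Since `PA = 0`, applying `1 - P` keeps `A x` and removes the term `d P x`, so the bound does
  -- not involve `d`.
  have hAx : ‖A x‖ ≤ h * ‖B x‖ := by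
    have e : A x - P (A x) = A x := by rw [hPAx, sub_zero]
    have e2 : ‖A x - P (A x)‖ = ‖h • B x - P (h • B x)‖ := by
      rcases hx with hx | hx
      · congr 1
        rw [hx, map_add, map_smul_of_tower P d, hPP]
        abel
      · rw [← norm_neg]
        congr 1
        rw [hx, map_neg, map_add, map_smul_of_tower P d, hPP]
        abel
    rw [← e, e2]
    refine (h1P _).trans_eq ?_
    rw [norm_smul, Real.norm_of_nonneg hh]
  have hy : ‖x - P x‖ ≤ C * ‖A x‖ := by
    have e : (u : H →L[ℂ] H) (x - P x) = A x := by
      rw [hu, add_apply, map_sub, map_sub, hPP, sub_self, add_zero]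
      have : A (P x) = 0 := congr($hAP x)
      rw [this, sub_zero]
    have e2 : x - P x = (↑u⁻¹ : H →L[ℂ] H) (A x) := by
      rw [← e]
      exact congr($(Units.inv_mul u) (x - P x)).symm
    rw [e2]
    exact le_opNorm _ _
  have hin : |(⟪x, A x⟫_ℂ).re| ≤ ‖x - P x‖ * ‖A x‖ := by
    have hsa : adjoint P = P := hP.isSelfAdjoint.star_eq
    have : ⟪P x, A x⟫_ℂ = 0 := by
      conv_lhs => enter [2]; rw [← hsa]
      rw [adjoint_inner_left, hPAx, inner_zero_right]
    have e : ⟪x, A x⟫_ℂ = ⟪x - P x, A x⟫_ℂ := by rw [inner_sub_left, this, sub_zero]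
    rw [e]
    exact (Complex.abs_re_le_norm _).trans (norm_inner_le_norm _ _)
  have hval : |(⟪x, A x⟫_ℂ).re| = h * ‖K x‖ ^ 2 + d * ‖P x‖ ^ 2 := by
    have e : (⟪x, h • B x + d • P x⟫_ℂ).re = h * ‖K x‖ ^ 2 + d * ‖P x‖ ^ 2 := by
      rw [inner_add_right, inner_smul_right_eq_smul, inner_smul_right_eq_smul, Complex.add_re,
        Complex.smul_re, Complex.smul_re, hq, hp]
      rfl
    have h0 : 0 ≤ h * ‖K x‖ ^ 2 + d * ‖P x‖ ^ 2 := by positivity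
    rcases hx with hx | hx
    · rw [hx, e, abs_of_nonneg h0]
    · rw [hx, inner_neg_right, Complex.neg_re, e, abs_neg, abs_of_nonneg h0]
  have hC0 : 0 ≤ C := norm_nonneg _
  have hbound : h * ‖K x‖ ^ 2 + d * ‖P x‖ ^ 2 ≤ h * (h * (C * ‖K‖ ^ 2)) * ‖K x‖ ^ 2 := by
    rw [← hval]
    calc |(⟪x, A x⟫_ℂ).re| ≤ C * ‖A x‖ * ‖A x‖ :=
          hin.trans (mul_le_mul_of_nonneg_right hy (norm_nonneg _))
      _ ≤ C * (h * (‖K‖ * ‖K x‖)) * (h * (‖K‖ * ‖K x‖)) := by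
          have := hAx.trans (mul_le_mul_of_nonneg_left hBx hh)
          gcongr
      _ = _ := by ring
  have hlt : h * (C * ‖K‖ ^ 2) < 1 := by linarith
  have hdP : 0 ≤ d * ‖P x‖ ^ 2 := by positivity
  have hhK : 0 ≤ h * ‖K x‖ ^ 2 := by positivity
  have z1 : h * ‖K x‖ ^ 2 = 0 := by
    by_contra hne
    have : 0 < h * ‖K x‖ ^ 2 := lt_of_le_of_ne hhK (Ne.symm hne)
    nlinarith
  have z2 : d * ‖P x‖ ^ 2 = 0 := by nlinarith
  rcases hpos with hpos | hpos
  · have hKx : K x = 0 := by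
      simpa [hpos.ne'] using z1
    have hBx0 : B x = 0 := by rw [hBK, hKx, map_zero]
    rw [hBx0, norm_zero, mul_zero] at hAx
    exact hker x (norm_le_zero_iff.1 hAx) hBx0
  · have hPx : P x = 0 := by
      simpa [hpos.ne'] using z2
    have hhB : h • B x = 0 := by
      rcases mul_eq_zero.1 z1 with h0 | h0
      · rw [h0, zero_smul]
      · have : K x = 0 := by simpa using h0
        rw [hBK, this, map_zero, smul_zero]
    have hAx0 : A x = 0 := by
      rw [hhB, hPx, smul_zero, add_zero, neg_zero, or_self] at hx
      exact hx
    rw [hAx0, norm_zero, mul_zero, hPx, sub_zero] at hy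
    exact norm_le_zero_iff.1 hy

theorem HasNuclearTrace.zero : HasNuclearTrace (0 : H →L[ℂ] H) 0 :=
  ⟨.zero _, ⟨0, by simp⟩, fun w b => by simp⟩

/-- Behaviour of the negative spectral projection near an operator with finite-dimensional
kernel under perturbations of definite sign. -/
theorem exists_hasNuclearTrace_near {A B P : H →L[ℂ] H} (hA : IsSelfAdjoint A) (hB : 0 ≤ B)
    (hK : IsHilbertSchmidt (CFC.sqrt B)) (hP : IsStarProjection P) (hPs : IsHilbertSchmidt P)
    (hAP : A * P = 0) (hu : IsUnit (A + P)) (hker : ∀ x, A x = 0 → B x = 0 → x = 0) :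
    ∃ ε > (0 : ℝ), ∀ h : ℝ, 0 < h → h < ε →
      (∀ x, (A + h • B) x = 0 → x = 0) ∧ (∀ x, (A - h • B) x = 0 → x = 0) ∧
      HasNuclearTrace (Xi (A + h • B) - Xi A) 0 ∧
      HasNuclearTrace (Xi (A - h • B) - (Xi A + P)) 0 := by
  obtain ⟨ε, hε, H1⟩ := exists_injective_near hA hB hP hAP hu hker
  refine ⟨ε, hε, fun h hh0 hhε => ?_⟩
  have hinjp : ∀ h' d : ℝ, 0 ≤ h' → h' < ε → 0 ≤ d → (0 < h' ∨ 0 < d) → ∀ x,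
      (A + (h' • B + d • P)) x = 0 → x = 0 := fun h' d h1 h2 h3 h4 x hx =>
    H1 h' d h1 h2 h3 h4 x (Or.inr (eq_neg_of_add_eq_zero_left hx))
  have hinjm : ∀ h' d : ℝ, 0 ≤ h' → h' < ε → 0 ≤ d → (0 < h' ∨ 0 < d) → ∀ x,
      (A - (h' • B + d • P)) x = 0 → x = 0 := fun h' d h1 h2 h3 h4 x hx =>
    H1 h' d h1 h2 h3 h4 x (Or.inl (sub_eq_zero.1 hx))
  have hBeq : CFC.sqrt B * CFC.sqrt B = B := CFC.sqrt_mul_sqrt_self B hB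
  have hBc : IsCompactOperator B := by
    rw [← hBeq]
    exact hK.isCompactOperator.comp_clm (CFC.sqrt B)
  have hPc : IsCompactOperator P := hPs.isCompactOperator
  have hsmul : ∀ (r : ℝ) (T : H →L[ℂ] H), r • T = (r • 1) * T := fun r T => by simp
  have hDn : IsNuclear (h • B - P) := by
    rw [sub_eq_add_neg]
    refine IsNuclear.add ?_ (IsNuclear.neg ?_)
    · rw [hsmul, ← hBeq, ← mul_assoc]
      exact .of_mul (hK.mul_left _) hK
    · rw [← hP.isIdempotentElem.eq]
      exact .of_mul hPs hPs
  have hDsa : IsSelfAdjoint (h • B - P) := by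
    rw [IsSelfAdjoint, star_sub, star_smul, hB.isSelfAdjoint.star_eq, hP.isSelfAdjoint.star_eq,
      star_trivial]
  -- The increment `hB - P` need not have a sign, so its factorization comes from nuclearity and not
  -- from a square root.
  obtain ⟨F, G, hF, hG, hFG⟩ := hDn.exists_eq_mul hDsa
  have hcomp : ∀ r s : ℝ, IsCompactOperator (r • B + s • P : H →L[ℂ] H) := fun r s => by
    rw [hsmul r, hsmul s]
    exact (hBc.clm_comp (r • (1 : H →L[ℂ] H))).add (hPc.clm_comp (s • (1 : H →L[ℂ] H)))
  have hup : ∀ h' d : ℝ, 0 ≤ h' → h' < ε → 0 ≤ d → (0 < h' ∨ 0 < d) →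
      IsUnit (A + (h' • B + d • P)) := fun h' d h1 h2 h3 h4 => by
    have e : A + (h' • B + d • P) = (A + P) + (h' • B + (d - 1) • P) := by
      rw [sub_smul, one_smul]
      abel
    rw [e]
    refine isUnit_add_of_isCompactOperator hu (hcomp _ _) ?_
    rw [← e]
    exact hinjp h' d h1 h2 h3 h4
  have hum : ∀ h' d : ℝ, 0 ≤ h' → h' < ε → 0 ≤ d → (0 < h' ∨ 0 < d) →
      IsUnit (A - (h' • B + d • P)) := fun h' d h1 h2 h3 h4 => by
    have e : A - (h' • B + d • P) = (A + P) + ((-h') • B + (-d - 1) • P) := by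
      rw [sub_smul, one_smul, neg_smul, neg_smul]
      abel
    rw [e]
    refine isUnit_add_of_isCompactOperator hu (hcomp _ _) ?_
    rw [← e]
    exact hinjm h' d h1 h2 h3 h4
  -- The coefficients of `B` and `P` along the segment are `th` and `1 - t`, never both zero.
  have hseg : ∀ t ∈ Set.Icc (0 : ℝ) 1, 0 ≤ t * h ∧ t * h < ε ∧ 0 ≤ 1 - t ∧
      (0 < t * h ∨ 0 < 1 - t) := fun t ht => by
    refine ⟨mul_nonneg ht.1 hh0.le, ?_, by linarith [ht.2], ?_⟩
    · exact (mul_le_of_le_one_left hh0.le ht.2).trans_lt hhε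
    · rcases ht.1.eq_or_lt with h0 | h0
      · right
        rw [← h0]
        norm_num
      · exact Or.inl (mul_pos h0 hh0)
  refine ⟨?_, ?_, ?_, ?_⟩
  · simpa using hinjp h 0 hh0.le hhε le_rfl (Or.inl hh0)
  · simpa using hinjm h 0 hh0.le hhε le_rfl (Or.inl hh0)
  · have h2 := hasNuclearTrace_Xi_sub_of_isUnit_segment (A := A + P) (F := F) (G := G)
      (hA.add hP.isSelfAdjoint) (hFG ▸ hDsa) hF hG fun t ht => by
        obtain ⟨a1, a2, a3, a4⟩ := hseg t ht
        convert hup _ _ a1 a2 a3 a4 using 1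
        rw [← hFG, smul_sub, sub_smul, one_smul, smul_smul]
        abel
    rw [← hFG, Xi_add_of_mul_eq_zero hA hP hAP] at h2
    convert h2 using 3
    abel
  · have h2 := hasNuclearTrace_Xi_sub_of_isUnit_segment (A := A - P) (F := (-1) * F) (G := G)
      (hA.sub hP.isSelfAdjoint) (by rw [mul_assoc, ← hFG, neg_one_mul]; exact hDsa.neg)
      (hF.mul_left _) hG fun t ht => by
        obtain ⟨a1, a2, a3, a4⟩ := hseg t ht
        convert hum _ _ a1 a2 a3 a4 using 1
        rw [mul_assoc, ← hFG, neg_one_mul, smul_neg, smul_sub, sub_smul, one_smul, smul_smul]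
        abel
    rw [mul_assoc, ← hFG, neg_one_mul, Xi_sub_of_mul_eq_zero hA hP hAP] at h2
    convert h2 using 3
    abel

/-! ### Counting the crossings along `s ↦ S + s B` -/

section Pencil

variable {S B : H →L[ℂ] H}

theorem finiteDimensional_ker_pencil (hB : IsCompactOperator B) {τ : ℝ} (hu : IsUnit (S + τ • B))
    (s : ℝ) : FiniteDimensional ℂ (S + s • B).ker := by
  have e : S + s • B = (S + τ • B) + ((s - τ) • (1 : H →L[ℂ] H)) * B := by
    rw [smul_mul_assoc, one_mul, sub_smul]
    abel
  rw [e]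
  have hc : IsCompactOperator (((s - τ) • (1 : H →L[ℂ] H)) * B : H →L[ℂ] H) :=
    hB.clm_comp ((s - τ) • (1 : H →L[ℂ] H))
  exact finiteDimensional_ker_add hu hc

variable (hS : IsSelfAdjoint S) (hB : 0 ≤ B) (hK : IsHilbertSchmidt (CFC.sqrt B)) {τ : ℝ}
  (hu : IsUnit (S + τ • B))
include hS hB hK hu

omit hS hu in
theorem isCompactOperator_of_sqrt : IsCompactOperator B := by
  rw [← CFC.sqrt_mul_sqrt_self B hB]
  exact hK.isCompactOperator.comp_clm (CFC.sqrt B)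

/-- The strict inequality `x < s` reflects that `Ξ` omits the kernel: it is lost on reaching `s`,
not on leaving it. Hence the half-open intervals `(a, b]` in the count. -/
theorem exists_hasNuclearTrace_pencil_near (s : ℝ) :
    ∃ ε > (0 : ℝ), ∀ x ∈ Metric.ball s ε,
      (x ≠ s → Module.finrank ℂ (S + x • B).ker = 0) ∧
      HasNuclearTrace (Xi (S + x • B) - Xi (S + s • B))
        ((if x < s then Module.finrank ℂ (S + s • B).ker else 0 : ℕ) : ℂ) := by
  have hBc := isCompactOperator_of_sqrt hB hK
  have hfd := finiteDimensional_ker_pencil hBc hu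
  set A := S + s • B with hAdef
  set N := A.ker with hN
  have : FiniteDimensional ℂ N := hfd s
  have hA : IsSelfAdjoint A := by
    rw [IsSelfAdjoint, hAdef, star_add, star_smul, hS.star_eq, hB.isSelfAdjoint.star_eq,
      star_trivial]
  set P := N.starProjection with hPdef
  have hP : IsStarProjection P := isStarProjection_starProjection
  have hPs : IsHilbertSchmidt P := isHilbertSchmidt_starProjection N
  have hAP : A * P = 0 := by
    ext x
    exact N.starProjection_apply_mem x
  have hPA := mul_eq_zero_symm hA hP.isSelfAdjoint hAP
  have hinj : Function.Injective (S + τ • B) := (isUnit_iff_bijective.1 hu).1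
  have hker : ∀ x, A x = 0 → B x = 0 → x = 0 := fun x h1 h2 => by
    refine hinj ?_
    rw [map_zero, add_apply, smul_apply, h2, smul_zero, add_zero]
    rwa [hAdef, add_apply, smul_apply, h2, smul_zero, add_zero] at h1
  -- If `(A + P)x = 0`, applying `P` gives `Px = 0`, so `Ax = 0` and `x = Px = 0`; the Fredholm
  -- alternative does the rest.
  have hAu : IsUnit (A + P) := by
    have e : A + P = (S + τ • B) + (((s - τ) • (1 : H →L[ℂ] H)) * B + P) := by
      rw [hAdef, smul_mul_assoc, one_mul, sub_smul]
      abel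
    have hc : IsCompactOperator (((s - τ) • (1 : H →L[ℂ] H)) * B + P : H →L[ℂ] H) :=
      (hBc.clm_comp ((s - τ) • (1 : H →L[ℂ] H))).add hPs.isCompactOperator
    rw [e]
    refine isUnit_add_of_isCompactOperator hu hc ?_
    rw [← e]
    intro x hx
    have hPx : P x = 0 := by
      have h1 : (P * (A + P)) x = 0 := by
        change P ((A + P) x) = 0
        rw [hx, map_zero]
      rwa [mul_add, hPA, hP.isIdempotentElem.eq, zero_add] at h1
    have hAx : x ∈ N := by
      rw [add_apply, hPx, add_zero] at hx
      exact hx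
    rw [← hPx]
    exact (Submodule.starProjection_eq_self_iff.2 hAx).symm
  obtain ⟨ε, hε, H1⟩ := exists_hasNuclearTrace_near hA hB hK hP hPs hAP hAu hker
  refine ⟨ε, hε, fun x hx => ?_⟩
  rw [Metric.mem_ball, Real.dist_eq, abs_lt] at hx
  have hz : ∀ {T : H →L[ℂ] H}, (∀ x, T x = 0 → x = 0) → Module.finrank ℂ T.ker = 0 := by
    intro T hT
    have : T.ker = ⊥ := (Submodule.eq_bot_iff _).2 hT
    rw [this, finrank_bot]
  rcases lt_trichotomy x s with h | h | h
  · obtain ⟨-, h1, -, h2⟩ := H1 (s - x) (by linarith) (by linarith)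
    have e : A - (s - x) • B = S + x • B := by
      rw [hAdef, sub_smul]
      abel
    rw [e] at h1 h2
    refine ⟨fun _ => hz h1, ?_⟩
    rw [if_pos h]
    convert h2.add (hasNuclearTrace_starProjection N) using 1
    · abel
    · rw [zero_add]
  · subst h
    refine ⟨fun h => absurd rfl h, ?_⟩
    rw [if_neg (lt_irrefl _), sub_self, Nat.cast_zero]
    exact .zero
  · obtain ⟨h1, -, h2, -⟩ := H1 (x - s) (by linarith) (by linarith)
    have e : A + (x - s) • B = S + x • B := by
      rw [hAdef, sub_smul]
      abel
    rw [e] at h1 h2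
    refine ⟨fun _ => hz h1, ?_⟩
    rwa [if_neg (not_lt.2 h.le), Nat.cast_zero]

/-- Each ball of the local lemma contains at most its centre as a crossing, and finitely many balls
cover the interval. -/
theorem finite_finrank_ker_pencil_ne_zero (a b : ℝ) :
    {s ∈ Set.Icc a b | Module.finrank ℂ (S + s • B).ker ≠ 0}.Finite := by
  choose ε hε H1 using exists_hasNuclearTrace_pencil_near hS hB hK hu
  obtain ⟨t, -, ht⟩ := (isCompact_Icc (a := a) (b := b)).elim_nhds_subcover
    (fun s => Metric.ball s (ε s)) fun s _ => Metric.ball_mem_nhds s (hε s)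
  refine t.finite_toSet.subset fun s hs => ?_
  obtain ⟨r, hr, hsr⟩ := Set.mem_iUnion₂.1 (ht hs.1)
  have : s = r := by
    by_contra hne
    exact hs.2 ((H1 r s hsr).1 hne)
  rwa [this]

/-- The trace of the difference of the negative spectral projections counts the crossings. -/
theorem hasNuclearTrace_pencil {a b : ℝ} (hab : a ≤ b) :
    HasNuclearTrace (Xi (S + b • B) - Xi (S + a • B))
      (-((∑ᶠ s ∈ Set.Ioc a b, Module.finrank ℂ (S + s • B).ker : ℕ) : ℂ)) := by
  have hfin := finite_finrank_ker_pencil_ne_zero hS hB hK hu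
  choose ε hε H1 using exists_hasNuclearTrace_pencil_near hS hB hK hu
  set d : ℝ → ℕ := fun s => Module.finrank ℂ (S + s • B).ker with hd
  -- Within one ball both endpoints are compared with its centre `r`, the only possible crossing,
  -- which counts exactly when `x < r ≤ y`.
  have hloc : ∀ r x y, x ≤ y → x ∈ Metric.ball r (ε r) → y ∈ Metric.ball r (ε r) →
      HasNuclearTrace (Xi (S + y • B) - Xi (S + x • B))
        (-((∑ᶠ s ∈ Set.Ioc x y, d s : ℕ) : ℂ)) := fun r x y hxy hx hy => by
    have hz : ∀ s ∈ Set.Ioc x y, s ≠ r → d s = 0 := fun s hs hne => by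
      refine (H1 r s ?_).1 hne
      rw [Real.ball_eq_Ioo] at hx hy ⊢
      exact ⟨hx.1.trans hs.1, hs.2.trans_lt hy.2⟩
    have h2 := (H1 r y hy).2.add (H1 r x hx).2.neg
    have e : ((if y < r then d r else 0 : ℕ) : ℂ) + -((if x < r then d r else 0 : ℕ) : ℂ) =
        -((∑ᶠ s ∈ Set.Ioc x y, d s : ℕ) : ℂ) := by
      by_cases hr : r ∈ Set.Ioc x y
      · have : ∑ᶠ s ∈ Set.Ioc x y, d s = d r := by
          rw [finsum_eq_single (fun s => ∑ᶠ _ : s ∈ Set.Ioc x y, d s) r fun s hs =>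
            finsum_eq_if.trans (ite_eq_right_iff.2 fun h => hz s h hs)]
          exact finsum_eq_if.trans (if_pos hr)
        rw [this, if_neg (not_lt.2 hr.2), if_pos hr.1, Nat.cast_zero, zero_add]
      · have : ∑ᶠ s ∈ Set.Ioc x y, d s = 0 :=
          finsum_mem_eq_zero_of_forall_eq_zero fun s hs => hz s hs fun h => hr (h ▸ hs)
        rw [this, Nat.cast_zero, neg_zero]
        by_cases h1 : x < r
        · have h3 : y < r := by
            by_contra h4
            exact hr ⟨h1, not_lt.1 h4⟩
          rw [if_pos h1, if_pos h3, add_neg_cancel]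
        · have h3 : ¬ y < r := fun h4 => h1 (hxy.trans_lt h4)
          rw [if_neg h1, if_neg h3, add_neg_cancel]
    rw [← e]
    convert h2 using 1
    abel
  obtain ⟨t, ht0, htm, ⟨m, hm⟩, htc⟩ := exists_monotone_Icc_subset_open_cover_Icc hab
    (c := fun r : ℝ => Subtype.val ⁻¹' Metric.ball r (ε r))
    (fun r => Metric.isOpen_ball.preimage continuous_subtype_val)
    (fun x _ => Set.mem_iUnion.2 ⟨x, Metric.mem_ball_self (hε x)⟩)
  have key : ∀ n, HasNuclearTrace (Xi (S + (t n : ℝ) • B) - Xi (S + a • B))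
      (-((∑ᶠ s ∈ Set.Ioc a (t n : ℝ), d s : ℕ) : ℂ)) := by
    intro n
    induction n with
    | zero =>
      rw [ht0, sub_self, Set.Ioc_self, finsum_mem_empty, Nat.cast_zero, neg_zero]
      exact .zero
    | succ n ih =>
      have hle : (t n : ℝ) ≤ t (n + 1) := htm n.le_succ
      obtain ⟨r, hr⟩ := htc n
      have h2 := hloc r (t n) (t (n + 1)) hle (hr ⟨le_rfl, hle⟩) (hr ⟨hle, le_rfl⟩)
      -- A `finsum` with infinite support is zero by convention, so additivity over adjacent
      -- intervals needs finiteness of the crossings.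
      have hsupp : ∀ x y, (Set.Ioc x y ∩ Function.support d).Finite := fun x y =>
        (hfin x y).subset fun s hs => ⟨Set.Ioc_subset_Icc_self hs.1, hs.2⟩
      have h3 : ∑ᶠ s ∈ Set.Ioc a (t (n + 1) : ℝ), d s =
          (∑ᶠ s ∈ Set.Ioc a (t n : ℝ), d s) + ∑ᶠ s ∈ Set.Ioc (t n : ℝ) (t (n + 1)), d s := by
        rw [← Set.Ioc_union_Ioc_eq_Ioc (t n).2.1 hle,
          finsum_mem_union' (Set.Ioc_disjoint_Ioc_of_le le_rfl) (hsupp _ _) (hsupp _ _)]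
      have h4 := ih.add h2
      rw [h3, Nat.cast_add, neg_add]
      convert h4 using 1
      abel
  have h := key m
  rwa [hm m le_rfl] at h

end Pencil

theorem IsTraceClass.isHilbertSchmidt_sqrt {B : H →L[ℂ] H} (hB : 0 ≤ B) (h : IsTraceClass B) :
    IsHilbertSchmidt (CFC.sqrt B) := by
  obtain ⟨w, b, hb⟩ := h
  rw [CFC.abs_of_nonneg B hB] at hb
  exact .sqrt_of_summable hB b hb

end

theorem mainTheorem8 {H : Type*} [NormedAddCommGroup H] [InnerProductSpace ℂ H]
    [CompleteSpace H] (S B : H →L[ℂ] H) (hS : IsSelfAdjoint S) (hB : 0 ≤ B)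
    (hB₁ : IsTraceClass B) (hinv : ∃ τ₀ : ℝ, IsUnit (S + (τ₀ : ℂ) • B)) :
    (∀ s ∈ Set.Ioc (-1 : ℝ) 1, FiniteDimensional ℂ (S + (s : ℂ) • B).ker) ∧
    {s ∈ Set.Ioc (-1 : ℝ) 1 | (S + (s : ℂ) • B).ker ≠ ⊥}.Finite ∧
    HasTrace (Xi (S + B) - Xi S)
      (-((∑ᶠ s ∈ Set.Ioc (0 : ℝ) 1, Module.finrank ℂ (S + (s : ℂ) • B).ker : ℕ) : ℂ)) ∧
    HasTrace (Xi (S - B) - Xi S)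
      ((∑ᶠ s ∈ Set.Ioc (-1 : ℝ) 0, Module.finrank ℂ (S + (s : ℂ) • B).ker : ℕ) : ℂ) := by
  obtain ⟨τ, hτ⟩ := hinv
  have hsm : ∀ s : ℝ, (s : ℂ) • B = s • B := fun s => Complex.coe_smul s B
  simp_rw [hsm] at hτ ⊢
  have hK := hB₁.isHilbertSchmidt_sqrt hB
  have hfd := finiteDimensional_ker_pencil (isCompactOperator_of_sqrt hB hK) hτ
  refine ⟨fun s _ => hfd s, ?_, ?_, ?_⟩
  · refine (finite_finrank_ker_pencil_ne_zero hS hB hK hτ (-1) 1).subset fun s hs =>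
      ⟨Set.Ioc_subset_Icc_self hs.1, fun h => hs.2 ?_⟩
    -- Finite dimension is needed here: `finrank` is also zero on infinite-dimensional spaces.
    have := hfd s
    exact Submodule.finrank_eq_zero.1 h
  · simpa using (hasNuclearTrace_pencil hS hB hK hτ zero_le_one).hasTrace
  -- The pencil runs from `-1` to `0`, so `Ξ(S - B) - Ξ(S)` is the negative of its increment, which
  -- flips the sign.
  · simpa [← sub_eq_add_neg] using
      (hasNuclearTrace_pencil hS hB hK hτ (neg_one_lt_zero.le : (-1 : ℝ) ≤ 0)).neg.hasTrace
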